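/- **Setting.** A complete parenthesization of a list of length $j\ge 1$ is defined inductively: $V(1)=\{1\}$ and $V(j)=\coprod_{k=1}^{j-1}V(k)\times V(j-k)$ for $j\ge 2$. Let $Z$ be the non-symmetric operad of sets with $$Z(n)=\coprod_{j\ge n}V(j)\times\{S\subset\{1,\dots,j\}:|S|=n\},$$ where $(\beta,S)\in Z(n)$ is thought of as a parenthesized list with variable slots in the positions in $S$ and a fixed letter "unit" in the other positions; composition $\Gamma$ is substitution into the variable slots, taken from left to right, and $(1,\{1\})$ is the identity. For a non-symmetric operad $Q$ of sets let $LQ$ be the free symmetric operad on $Q$: $LQ(n)=Q(n)\times\Sigma_n$, with $\Sigma_n$ acting by right multiplication and $$\Gamma((q,\sigma);(r_1,\tau_1),\dots,(r_n,\tau_n))=\bigl(\Gamma(q;r_{\sigma^{-1}1},\dots,r_{\sigma^{-1}n}),\ \sigma\langle k_1,\dots,k_n\rangle\circ(\tau_1\oplus\cdots\oplus\tau_n)\bigr)$$ for $(r_i,\tau_i)\in LQ(k_i)$, where $\sigma\langle k_1,\dots,k_n\rangle$ permutes blocks of lengths $k_1,\dots,k_n$ as $\sigma$ permutes $1,\dots,n$.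 For a symmetric operad $P$ of sets let $EP$ be the categorical operad for which $EP(n)$ is the category with object set $P(n)$ and exactly one morphism between any two objects. Put $Y=ELZ$. A $Y$-algebra structure on a category $\mathcal C$ consists of functors $Y(n)\times\mathcal C^n\to\mathcal C$, $n\ge 0$, that are strictly unital, associative and equivariant; maps of $Y$-algebras are the functors that commute strictly with these. Strict maps of symmetric monoidal categories are the functors that preserve the unit object, the tensor product, and the associativity, left unit, right unit and symmetry isomorphisms on the nose. **Theorem.** Let $Y=ELZ$. For every (small) category $\mathcal C$, symmetric monoidal structures on $\mathcal C$ correspond bijectively to $Y$-algebra structures on $\mathcal C$. Under this bijection the unit object $e$ and the product $\otimes$ are the actions of $(1,\emptyset)\in Z(0)$ and $((1,1),\{1,2\})\in Z(2)$ (with identity permutations), and the structure isomorphisms are the images of the unique isomorphisms in $Y$ as follows (operations in $Z$ are taken with the identity permutation): - $(a\otimes b)\otimes c\cong a\otimes(b\otimes c)$ is the image of $(((1,1),1),\{1,2,3\})\cong((1,(1,1)),\{1,2,3\})$ in $Y(3)$; - $a\otimes e\cong a$ is the image of $((1,1),\{1\})\cong(1,\{1\})$ in $Y(1)$; - $e\otimes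 a\cong a$ is the image of $((1,1),\{2\})\cong(1,\{1\})$ in $Y(1)$; - $a\otimes b\cong b\otimes a$ is the image of $(((1,1),\{1,2\}),1_2)\cong(((1,1),\{1,2\}),t)$ in $Y(2)$, where $1_2$ is the identity and $t$ the non-identity element of $\Sigma_2$. The bijection extends to an isomorphism between the category of $Y$-algebras (and maps of $Y$-algebras) and the category of symmetric monoidal categories and strict maps: there are mutually inverse functors between the two categories which are the identity on underlying categories and underlying functors and which are given on objects by the bijection. -/

import Mathlib

namespace ELZ

open CategoryTheory

/-! ### Operads of sets -/

/-- A non-symmetric operad of sets.  Operations `p : Op m`, `p' : Op m'` whose arities agree only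
up to a provable equality are compared as elements of the disjoint union `Σ n, Op n`.  The
inputs of `comp p q` are numbered lexicographically: input `j` of `q i` is
`finSigmaFinEquiv ⟨i, j⟩`. -/
structure NSOperad where
  Op : ℕ → Type
  one : Op 1
  comp : ∀ {n : ℕ} (_ : Op n) {k : Fin n → ℕ} (_ : ∀ i, Op (k i)), Op (∑ i, k i)
  one_comp : ∀ {k : Fin 1 → ℕ} (q : ∀ i, Op (k i)),
    (⟨_, comp one q⟩ : Σ n, Op n) = ⟨k 0, q 0⟩
  comp_one : ∀ {n : ℕ} (p : Op n),
    (⟨_, comp p (fun _ : Fin n => one)⟩ : Σ n, Op n) = ⟨n, p⟩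
  assoc : ∀ {n : ℕ} (p : Op n) {k : Fin n → ℕ} (q : ∀ i, Op (k i))
    {l : Fin (∑ i, k i) → ℕ} (r : ∀ x, Op (l x)),
    (⟨_, comp (comp p q) r⟩ : Σ n, Op n) =
      ⟨_, comp p (fun i => comp (q i) (fun j => r (finSigmaFinEquiv ⟨i, j⟩)))⟩

/-- The direct sum `τ₁ ⊕ ⋯ ⊕ τₙ` of permutations. -/
def sumPerm {n : ℕ} {k : Fin n → ℕ} (τ : ∀ i, Equiv.Perm (Fin (k i))) :
    Equiv.Perm (Fin (∑ i, k i)) :=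
  finSigmaFinEquiv.symm.trans ((Equiv.sigmaCongrRight τ).trans finSigmaFinEquiv)

theorem sum_comp_symm {n : ℕ} (σ : Equiv.Perm (Fin n)) (k : Fin n → ℕ) :
    ∑ i, k (σ.symm i) = ∑ i, k i :=
  Equiv.sum_comp σ.symm k

/-- The block permutation `σ⟨k₁, …, kₙ⟩`: it permutes consecutive blocks of lengths `k₁, …, kₙ` the
way `σ` permutes `1, …, n`, so block `i` is moved to block position `σ i`. -/
def blockPerm {n : ℕ} (σ : Equiv.Perm (Fin n)) (k : Fin n → ℕ) :
    Equiv.Perm (Fin (∑ i, k i)) :=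
  finSigmaFinEquiv.symm.trans
    ((Equiv.sigmaCongrLeft (β := fun i => Fin (k i)) σ.symm).symm.trans
      (finSigmaFinEquiv.trans (finCongr (sum_comp_symm σ k))))

/-- Transport of an operation along an equality of arities. -/
def castOp {Op : ℕ → Type} {m n : ℕ} (h : m = n) (p : Op m) : Op n := h ▸ p

/-- A symmetric operad of sets, with the symmetric groups acting from the right. -/
structure SymmOperad extends NSOperad where
  perm : ∀ {n : ℕ}, Op n → Equiv.Perm (Fin n) → Op n
  perm_one : ∀ {n : ℕ} (p : Op n), perm p 1 = p
  perm_mul : ∀ {n : ℕ} (p : Op n) (σ τ : Equiv.Perm (Fin n)),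
    perm p (σ * τ) = perm (perm p σ) τ
  comp_perm : ∀ {n : ℕ} (p : Op n) {k : Fin n → ℕ} (q : ∀ i, Op (k i))
    (τ : ∀ i, Equiv.Perm (Fin (k i))),
    comp p (fun i => perm (q i) (τ i)) = perm (comp p q) (sumPerm τ)
  perm_comp : ∀ {n : ℕ} (p : Op n) (σ : Equiv.Perm (Fin n)) {k : Fin n → ℕ}
    (q : ∀ i, Op (k i)),
    comp (perm p σ) q =
      perm (castOp (sum_comp_symm σ k) (comp p (fun i => q (σ.symm i)))) (blockPerm σ k)

/-! ### The operad `Z` -/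

theorem pos_castAdd {a b : ℕ} (k : Fin (a + b) → ℕ) (i : Fin a) (j : Fin (k (Fin.castAdd b i))) :
    (finSigmaFinEquiv (n := k) ⟨Fin.castAdd b i, j⟩ : ℕ) =
      (finSigmaFinEquiv (n := fun i => k (Fin.castAdd b i)) ⟨i, j⟩ : ℕ) := by
  simp only [finSigmaFinEquiv_apply]
  rfl

theorem pos_natAdd {a b : ℕ} (k : Fin (a + b) → ℕ) (i : Fin b) (j : Fin (k (Fin.natAdd a i))) :
    (finSigmaFinEquiv (n := k) ⟨Fin.natAdd a i, j⟩ : ℕ) =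
      ∑ i, k (Fin.castAdd b i) +
        (finSigmaFinEquiv (n := fun i => k (Fin.natAdd a i)) ⟨i, j⟩ : ℕ) := by
  simp only [finSigmaFinEquiv_apply]
  rw [← add_assoc]
  congr 1
  exact Fin.sum_univ_add (fun x : Fin (a + i.1) => k (Fin.castLE (Fin.natAdd a i).2.le x))

theorem pos_congr {n : ℕ} {k k' : Fin n → ℕ} (h : ∀ i, k i = k' i) {i i' : Fin n}
    {j : Fin (k i)} {j' : Fin (k' i')} (hi : i = i') (hj : (j : ℕ) = j') :
    (finSigmaFinEquiv (n := k) ⟨i, j⟩ : ℕ) = (finSigmaFinEquiv (n := k') ⟨i', j'⟩ : ℕ) := by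
  obtain rfl : k = k' := funext h
  subst hi
  rw [Fin.ext hj]

theorem total_subtype_ext {T : Type} {f : T → ℕ} {m n : ℕ} {p : {t : T // f t = m}}
    {q : {t : T // f t = n}} (h : p.1 = q.1) :
    (⟨m, p⟩ : Σ n, {t : T // f t = n}) = ⟨n, q⟩ := by
  obtain ⟨p, rfl⟩ := p
  obtain ⟨q, rfl⟩ := q
  obtain rfl : p = q := h
  rfl

/-- Parenthesized words in two letters: `var`, a slot for a variable, and `unit`, a slot reserved
for the identity element.  Such a tree encodes a pair `(β, S)` of a complete parenthesization `β`
and a set `S` of slots in which a variable can appear: the leaves in `S` are `var`, the others are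
`unit`.  See `ZTree.bijective_toPair`. -/
inductive ZTree : Type
  | unit : ZTree
  | var : ZTree
  | node : ZTree → ZTree → ZTree

/-- The number of variable slots. -/
def ZTree.arity : ZTree → ℕ
  | .unit => 0
  | .var => 1
  | .node t u => t.arity + u.arity

/-- Complete parenthesizations. -/
inductive VTree : Type
  | one : VTree
  | pair : VTree → VTree → VTree

/-- The length of the parenthesized list: `V(n)` consists of the `β` with `β.leaves = n`. -/
def VTree.leaves : VTree → ℕ
  | .one => 1
  | .pair β γ => β.leaves + γ.leaves

/-- The union of `S` and the set `T` shifted by `m`. -/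
def joinSet {m n : ℕ} (S : Finset (Fin m)) (T : Finset (Fin n)) : Finset (Fin (m + n)) :=
  S.map (Fin.castAddEmb n) ∪ T.map (Fin.natAddEmb m)

theorem mem_left {m n : ℕ} (S : Finset (Fin m)) (T : Finset (Fin n)) (i : Fin m) :
    Fin.castAdd n i ∈ joinSet S T ↔ i ∈ S := by
  have (j : Fin n) : Fin.natAdd m j ≠ Fin.castAdd n i := fun h => by
    have := congrArg Fin.val h
    simp at this
    omega
  simp [joinSet, this]

theorem mem_right {m n : ℕ} (S : Finset (Fin m)) (T : Finset (Fin n)) (j : Fin n) :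
    Fin.natAdd m j ∈ joinSet S T ↔ j ∈ T := by
  have (i : Fin m) : Fin.castAdd n i ≠ Fin.natAdd m j := fun h => by
    have := congrArg Fin.val h
    simp at this
    omega
  simp [joinSet, this]

theorem joinSet_inj {m n : ℕ} {S S' : Finset (Fin m)} {T T' : Finset (Fin n)}
    (h : joinSet S T = joinSet S' T') : S = S' ∧ T = T' :=
  ⟨Finset.ext fun i => by rw [← mem_left S T, h, mem_left],
    Finset.ext fun i => by rw [← mem_right S T, h, mem_right]⟩

theorem joinSet_surj {m n : ℕ} (S : Finset (Fin (m + n))) : ∃ T U, joinSet T U = S := by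
  classical
  refine ⟨Finset.univ.filter fun i => Fin.castAdd n i ∈ S,
    Finset.univ.filter fun i => Fin.natAdd m i ∈ S, Finset.ext fun i => ?_⟩
  refine Fin.addCases (fun i => ?_) (fun i => ?_) i
  · rw [mem_left]
    simp
  · rw [mem_right]
    simp

theorem card_joinSet {m n : ℕ} (S : Finset (Fin m)) (T : Finset (Fin n)) :
    (joinSet S T).card = S.card + T.card := by
  refine (Finset.card_union_of_disjoint ?_).trans (by simp)
  rw [Finset.disjoint_left]
  intro x hx
  obtain ⟨i, hi, rfl⟩ := Finset.mem_map.1 hx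
  have := mem_left ∅ T i
  simpa [joinSet] using this

/-- The product `(β₁, S₁) · (β₂, S₂)`: juxtaposition of the parenthesizations, together with the
union of `S₁` and the set `S₂` shifted by the length of `β₁`. -/
def pairMul (x y : Σ β : VTree, Finset (Fin β.leaves)) : Σ β : VTree, Finset (Fin β.leaves) :=
  ⟨.pair x.1 y.1, joinSet x.2 y.2⟩

/-- The pair `(β, S)` of a parenthesization `β` and a set `S` of slots encoded by a tree. -/
def ZTree.toPair : ZTree → Σ β : VTree, Finset (Fin β.leaves)
  | .unit => ⟨.one, (∅ : Finset (Fin 1))⟩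
  | .var => ⟨.one, ({0} : Finset (Fin 1))⟩
  | .node t u => pairMul t.toPair u.toPair

theorem pairMul_injective {x y x' y' : Σ β : VTree, Finset (Fin β.leaves)}
    (h : pairMul x y = pairMul x' y') : x = x' ∧ y = y' := by
  obtain ⟨β, S⟩ := x
  obtain ⟨γ, T⟩ := y
  obtain ⟨β', S'⟩ := x'
  obtain ⟨γ', T'⟩ := y'
  obtain ⟨rfl, rfl⟩ := VTree.pair.inj (congrArg Sigma.fst h)
  obtain ⟨h1, h2⟩ := joinSet_inj (S := S) (T := T) (eq_of_heq (Sigma.mk.inj h).2)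
  exact ⟨congrArg (Sigma.mk β) h1, congrArg (Sigma.mk γ) h2⟩

theorem pairMul_surjective (β γ : VTree) (S : Finset (Fin (VTree.pair β γ).leaves)) :
    ∃ T U, pairMul ⟨β, T⟩ ⟨γ, U⟩ = ⟨.pair β γ, S⟩ := by
  obtain ⟨T, U, h⟩ := joinSet_surj (m := β.leaves) (n := γ.leaves) S
  exact ⟨T, U, congrArg (Sigma.mk (VTree.pair β γ)) h⟩

theorem ZTree.card_toPair : ∀ t : ZTree, t.toPair.2.card = t.arity
  | .unit => rfl
  | .var => rfl
  | .node t u => by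
      rw [ZTree.arity, ← ZTree.card_toPair t, ← ZTree.card_toPair u]
      exact card_joinSet _ _

/-- Trees are the same as pairs `(β, S)`, so the trees of arity `n` are the elements of `Z(n)`. -/
theorem ZTree.bijective_toPair : Function.Bijective ZTree.toPair := by
  constructor
  · intro t
    have ne : (⟨.one, (∅ : Finset (Fin 1))⟩ : Σ β : VTree, Finset (Fin β.leaves)) ≠
        ⟨.one, ({0} : Finset (Fin 1))⟩ := fun h =>
      (Finset.singleton_ne_empty (0 : Fin 1)) (eq_of_heq (Sigma.mk.inj h).2).symm
    induction t with
    | unit =>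
      intro t' h
      cases t' with
      | unit => rfl
      | var => exact absurd h ne
      | node t u => cases congrArg Sigma.fst h
    | var =>
      intro t' h
      cases t' with
      | var => rfl
      | unit => exact absurd h.symm ne
      | node t u => cases congrArg Sigma.fst h
    | node t u iht ihu =>
      intro t' h
      cases t' with
      | unit => cases congrArg Sigma.fst h
      | var => cases congrArg Sigma.fst h
      | node t' u' =>
        obtain ⟨h1, h2⟩ := pairMul_injective h
        rw [iht h1, ihu h2]
  · rintro ⟨β, S⟩
    induction β with
    | one =>
      rcases Finset.subset_singleton_iff.1 (show S ⊆ ({0} : Finset (Fin 1)) from fun x _ =>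
        Finset.mem_singleton.2 (Subsingleton.elim (α := Fin 1) x 0)) with h | h
      · exact ⟨.unit, congrArg (Sigma.mk VTree.one) h.symm⟩
      · exact ⟨.var, congrArg (Sigma.mk VTree.one) h.symm⟩
    | pair β γ ihβ ihγ =>
      obtain ⟨T, U, h⟩ := pairMul_surjective β γ S
      obtain ⟨t, ht⟩ := ihβ T
      obtain ⟨u, hu⟩ := ihγ U
      exact ⟨.node t u, by rw [ZTree.toPair, ht, hu, h]⟩

/-- Substitution of trees for the variable slots, from left to right. -/
def ZTree.subst : (t : ZTree) → (Fin t.arity → ZTree) → ZTree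
  | .unit, _ => .unit
  | .var, s => s (0 : Fin 1)
  | .node t u, s => .node (t.subst fun i => s (Fin.castAdd u.arity i))
      (u.subst fun i => s (Fin.natAdd t.arity i))

theorem ZTree.arity_subst : ∀ (t : ZTree) (s : Fin t.arity → ZTree),
    (t.subst s).arity = ∑ i, (s i).arity
  | .unit, s => (Fin.sum_univ_zero (fun i : Fin 0 => (s i).arity)).symm
  | .var, s => (Fin.sum_univ_one (fun i : Fin 1 => (s i).arity)).symm
  | .node t u, s => by
      simp only [ZTree.subst, ZTree.arity, ZTree.arity_subst t, ZTree.arity_subst u]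
      exact (Fin.sum_univ_add (fun i : Fin (t.arity + u.arity) => (s i).arity)).symm

theorem ZTree.subst_var : ∀ t : ZTree, (t.subst fun _ => .var) = t
  | .unit => rfl
  | .var => rfl
  | .node t u => by simp only [ZTree.subst, ZTree.subst_var t, ZTree.subst_var u]

theorem ZTree.subst_congr (t : ZTree) {s s' : Fin t.arity → ZTree} (h : ∀ i, s i = s' i) :
    t.subst s = t.subst s' := by
  rw [funext h]

theorem ZTree.subst_subst : ∀ (t : ZTree) (s : Fin t.arity → ZTree)
    (r : Fin (t.subst s).arity → ZTree),
    (t.subst s).subst r = t.subst fun i => (s i).subst fun j =>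
      r (Fin.cast (t.arity_subst s).symm
        (finSigmaFinEquiv (n := fun i => (s i).arity) ⟨i, j⟩))
  | .unit, s, r => rfl
  | .var, s, r => by
      refine ZTree.subst_congr (s (0 : Fin 1)) (fun j => congrArg r (Fin.ext ?_))
      exact (finSigmaFinEquiv_one (n := fun i : Fin 1 => (s i).arity) ⟨0, j⟩).symm
  | .node t u, s, r => by
      simp only [ZTree.subst]
      rw [ZTree.subst_subst t, ZTree.subst_subst u]
      congr 1
      · refine ZTree.subst_congr t (fun i => ZTree.subst_congr _ (fun j => congrArg r (Fin.ext ?_)))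
        exact (pos_castAdd (fun x : Fin (t.arity + u.arity) => (s x).arity) i j).symm
      · refine ZTree.subst_congr u (fun i => ZTree.subst_congr _ (fun j => congrArg r (Fin.ext ?_)))
        refine Eq.trans ?_ (pos_natAdd (fun x : Fin (t.arity + u.arity) => (s x).arity) i j).symm
        exact congrArg (· + _) (ZTree.arity_subst t _)

/-- The operad `Z`: `Z(n)` consists of the parenthesized words with exactly `n` slots in which a
variable can appear, and composition is substitution. -/
def Z : NSOperad where
  Op n := {t : ZTree // t.arity = n}
  one := ⟨.var, rfl⟩
  comp {n} p {k} q := ⟨p.1.subst fun i => (q (Fin.cast p.2 i)).1, by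
    obtain ⟨t, rfl⟩ := p
    rw [ZTree.arity_subst]
    exact Finset.sum_congr rfl fun i _ => (q i).2⟩
  one_comp q := total_subtype_ext rfl
  comp_one p := total_subtype_ext (ZTree.subst_var p.1)
  assoc {n} p {k} q {l} r := by
    obtain ⟨t, rfl⟩ := p
    refine total_subtype_ext ((ZTree.subst_subst _ _ _).trans ?_)
    refine ZTree.subst_congr t fun i => ZTree.subst_congr _ fun j => ?_
    refine congrArg (fun x => (r x).1) (Fin.ext ?_)
    exact pos_congr (fun x => (q x).2) rfl rfl

/-! ### The free symmetric operad functor `L` -/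

theorem total_pair_ext {Op : ℕ → Type} {m n : ℕ} {p : Op m} {q : Op n}
    {σ : Equiv.Perm (Fin m)} {τ : Equiv.Perm (Fin n)}
    (h : (⟨m, p⟩ : Σ n, Op n) = ⟨n, q⟩)
    (hσ : ∀ (i : Fin m) (j : Fin n), (i : ℕ) = j → (σ i : ℕ) = τ j) :
    (⟨m, (p, σ)⟩ : Σ n, Op n × Equiv.Perm (Fin n)) = ⟨n, (q, τ)⟩ := by
  cases h
  obtain rfl : σ = τ := Equiv.ext fun i => Fin.ext (hσ i i rfl)
  rfl

theorem total_castOp {Op : ℕ → Type} {m n : ℕ} (h : m = n) (p : Op m) :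
    (⟨n, castOp h p⟩ : Σ n, Op n) = ⟨m, p⟩ := by
  subst h
  rfl

theorem total_apply_congr {Op : ℕ → Type} {A : Type} {k : A → ℕ} (q : ∀ i, Op (k i)) {i j : A}
    (h : i = j) : (⟨k i, q i⟩ : Σ n, Op n) = ⟨k j, q j⟩ := by
  subst h
  rfl

theorem NSOperad.comp_congr (Q : NSOperad) {m n : ℕ} {p : Q.Op m} {p' : Q.Op n}
    {k : Fin m → ℕ} {k' : Fin n → ℕ} {q : ∀ i, Q.Op (k i)} {q' : ∀ i, Q.Op (k' i)}
    (h : (⟨m, p⟩ : Σ n, Q.Op n) = ⟨n, p'⟩)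
    (hq : ∀ (i : Fin m) (j : Fin n), (i : ℕ) = j → (⟨k i, q i⟩ : Σ n, Q.Op n) = ⟨k' j, q' j⟩) :
    (⟨_, Q.comp p q⟩ : Σ n, Q.Op n) = ⟨_, Q.comp p' q'⟩ := by
  cases h
  obtain rfl : k = k' := funext fun i => congrArg Sigma.fst (hq i i rfl)
  obtain rfl : q = q' := funext fun i => eq_of_heq (Sigma.mk.inj (hq i i rfl)).2
  rfl

theorem castOp_fst {Op : ℕ → Type} {m n : ℕ} (h : m = n) (p : Op m × Equiv.Perm (Fin m)) :
    (castOp (Op := fun n => Op n × Equiv.Perm (Fin n)) h p).1 = castOp h p.1 := by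
  subst h
  rfl

theorem castOp_snd {Op : ℕ → Type} {m n : ℕ} (h : m = n) (p : Op m × Equiv.Perm (Fin m))
    (x : Fin m) (y : Fin n) (hxy : (x : ℕ) = y) :
    ((castOp (Op := fun n => Op n × Equiv.Perm (Fin n)) h p).2 y : ℕ) = p.2 x := by
  subst h
  rw [Fin.ext hxy]
  rfl

theorem perm_val_congr {A : Type} {k : A → ℕ} (τ : ∀ i, Equiv.Perm (Fin (k i))) {i i' : A}
    (h : i = i') {a : Fin (k i)} {b : Fin (k i')} (hab : (a : ℕ) = b) :
    (τ i a : ℕ) = τ i' b := by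
  subst h
  rw [Fin.ext hab]

theorem perm_symm_val_congr {A : Type} {k : A → ℕ} (τ : ∀ i, Equiv.Perm (Fin (k i))) {i i' : A}
    (h : i = i') {a : Fin (k i)} {b : Fin (k i')} (hab : (a : ℕ) = b) :
    ((τ i).symm a : ℕ) = (τ i').symm b := by
  subst h
  rw [Fin.ext hab]

theorem sumPerm_apply {n : ℕ} {k : Fin n → ℕ} (τ : ∀ i, Equiv.Perm (Fin (k i))) (i : Fin n)
    (j : Fin (k i)) :
    sumPerm τ (finSigmaFinEquiv ⟨i, j⟩) = finSigmaFinEquiv ⟨i, τ i j⟩ := by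
  simp [sumPerm]

theorem blockPerm_symm_apply {n : ℕ} (σ : Equiv.Perm (Fin n)) (k : Fin n → ℕ) (i : Fin n)
    (j : Fin (k (σ.symm i))) :
    (blockPerm σ k).symm (Fin.cast (sum_comp_symm σ k)
      (finSigmaFinEquiv (n := fun i => k (σ.symm i)) ⟨i, j⟩)) =
      finSigmaFinEquiv ⟨σ.symm i, j⟩ := by
  simp [blockPerm]

theorem blockPerm_apply {n : ℕ} (σ : Equiv.Perm (Fin n)) (k : Fin n → ℕ) (i : Fin n)
    (j : Fin (k i)) (j' : Fin (k (σ.symm (σ i)))) (hj : (j : ℕ) = j') :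
    (blockPerm σ k (finSigmaFinEquiv ⟨i, j⟩) : ℕ) =
      finSigmaFinEquiv (n := fun i => k (σ.symm i)) ⟨σ i, j'⟩ := by
  have h := blockPerm_symm_apply σ k (σ i) j'
  rw [Equiv.symm_apply_eq] at h
  have h' : (finSigmaFinEquiv ⟨i, j⟩ : Fin (∑ i, k i)) = finSigmaFinEquiv ⟨σ.symm (σ i), j'⟩ :=
    Fin.ext (pos_congr (fun _ => rfl) (σ.symm_apply_apply i).symm hj)
  rw [h', ← h]
  rfl

/-- Every input of a composite is input `j` of block `i`. -/
theorem exists_pos {n : ℕ} {k : Fin n → ℕ} (x : Fin (∑ i, k i)) :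
    ∃ (i : Fin n) (j : Fin (k i)), x = finSigmaFinEquiv ⟨i, j⟩ :=
  ⟨(finSigmaFinEquiv.symm x).1, (finSigmaFinEquiv.symm x).2, by simp⟩

/-- The composition permutation `σ⟨k₁, …, kₙ⟩ ∘ (τ₁ ⊕ ⋯ ⊕ τₙ)` of `LQ`. -/
def compPerm {n : ℕ} (σ : Equiv.Perm (Fin n)) {k : Fin n → ℕ} (τ : ∀ i, Equiv.Perm (Fin (k i))) :
    Equiv.Perm (Fin (∑ i, k i)) :=
  blockPerm σ k * sumPerm τ

theorem compPerm_apply {n : ℕ} (σ : Equiv.Perm (Fin n)) {k : Fin n → ℕ}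
    (τ : ∀ i, Equiv.Perm (Fin (k i))) (i : Fin n)
    (j : Fin (k i)) (j' : Fin (k (σ.symm (σ i)))) (hj : (τ i j : ℕ) = j') :
    (compPerm σ τ (finSigmaFinEquiv ⟨i, j⟩) : ℕ) =
      finSigmaFinEquiv (n := fun i => k (σ.symm i)) ⟨σ i, j'⟩ := by
  rw [compPerm, Equiv.Perm.mul_apply, sumPerm_apply]
  exact blockPerm_apply σ k i _ j' hj

theorem compPerm_apply_cast {n : ℕ} (σ : Equiv.Perm (Fin n)) {k : Fin n → ℕ}
    (τ : ∀ i, Equiv.Perm (Fin (k i))) (i : Fin n) (j : Fin (k i)) :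
    (compPerm σ τ (finSigmaFinEquiv ⟨i, j⟩) : ℕ) =
      finSigmaFinEquiv (n := fun i => k (σ.symm i))
        ⟨σ i, Fin.cast (congrArg k (σ.symm_apply_apply i).symm) (τ i j)⟩ :=
  compPerm_apply σ τ i j _ rfl

theorem compPerm_symm_apply {n : ℕ} (σ : Equiv.Perm (Fin n)) {k : Fin n → ℕ}
    (τ : ∀ i, Equiv.Perm (Fin (k i))) (i : Fin n) (j : Fin (k (σ.symm i))) :
    (compPerm σ τ).symm (Fin.cast (sum_comp_symm σ k)
      (finSigmaFinEquiv (n := fun i => k (σ.symm i)) ⟨i, j⟩)) =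
      finSigmaFinEquiv ⟨σ.symm i, (τ (σ.symm i)).symm j⟩ := by
  rw [Equiv.symm_apply_eq, compPerm, Equiv.Perm.mul_apply, sumPerm_apply,
    Equiv.apply_symm_apply, ← blockPerm_symm_apply, Equiv.apply_symm_apply]

theorem pos_congr' {n n' : ℕ} (hn : n = n') {k : Fin n → ℕ} {k' : Fin n' → ℕ}
    (h : ∀ (i : Fin n) (i' : Fin n'), (i : ℕ) = i' → k i = k' i') {i : Fin n} {i' : Fin n'}
    {j : Fin (k i)} {j' : Fin (k' i')} (hi : (i : ℕ) = i') (hj : (j : ℕ) = j') :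
    (finSigmaFinEquiv (n := k) ⟨i, j⟩ : ℕ) = (finSigmaFinEquiv (n := k') ⟨i', j'⟩ : ℕ) := by
  subst hn
  exact pos_congr (fun i => h i i rfl) (Fin.ext hi) hj

theorem pos_eq {n : ℕ} {k : Fin n → ℕ} (i : Fin n) (j : Fin (k i)) :
    (finSigmaFinEquiv ⟨i, j⟩ : Fin (∑ i, k i)).1 = (∑ a, if a < i then k a else 0) + j := by
  rw [finSigmaFinEquiv_apply, ← Finset.sum_filter]
  congr 1
  refine Finset.sum_bij (fun a _ => Fin.castLE i.2.le a) ?_ ?_ ?_ ?_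
  · intro a _
    exact Finset.mem_filter.2 ⟨Finset.mem_univ _, a.2⟩
  · intro a _ b _ h
    simpa [Fin.ext_iff] using h
  · intro b hb
    exact ⟨⟨b.1, (Finset.mem_filter.1 hb).2⟩, Finset.mem_univ _, rfl⟩
  · intro a _
    rfl

theorem pos_lt {n : ℕ} {k : Fin n → ℕ} {i i' : Fin n} {j : Fin (k i)} {j' : Fin (k i')}
    (h : i < i') :
    (finSigmaFinEquiv ⟨i, j⟩ : Fin (∑ i, k i)).1 <
      (finSigmaFinEquiv ⟨i', j'⟩ : Fin (∑ i, k i)).1 := by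
  rw [pos_eq, pos_eq]
  have h1 : (∑ a, if a < i then k a else 0) + k i ≤ ∑ a, if a < i' then k a else 0 := by
    have h2 : k i = ∑ a, if a = i then k a else 0 := by simp
    rw [h2, ← Finset.sum_add_distrib]
    refine Finset.sum_le_sum fun a _ => ?_
    rcases lt_trichotomy a i with h3 | h3 | h3
    · simp [h3, h3.ne, h3.trans h]
    · simp [h3, h]
    · simp [h3.not_gt, h3.ne']
  have := j.2
  omega

theorem pos_lt_iff {n : ℕ} {k : Fin n → ℕ} {i i' : Fin n} {j : Fin (k i)} {j' : Fin (k i')} :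
    (finSigmaFinEquiv ⟨i, j⟩ : Fin (∑ i, k i)) < finSigmaFinEquiv ⟨i', j'⟩ ↔
      i < i' ∨ (i = i' ∧ (j : ℕ) < j') := by
  rw [Fin.lt_def]
  rcases lt_trichotomy i i' with h | h | h
  · exact iff_of_true (pos_lt h) (Or.inl h)
  · subst h
    simp
  · have := pos_lt (j := j') (j' := j) h
    exact iff_of_false this.not_gt (by simp [h.not_gt, h.ne'])

/-- Both ways of numbering triples lexicographically agree. -/
theorem pos_assoc {n : ℕ} {k : Fin n → ℕ} (l : Fin (∑ i, k i) → ℕ) (i : Fin n) (j : Fin (k i))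
    (c : Fin (l (finSigmaFinEquiv ⟨i, j⟩))) :
    (finSigmaFinEquiv ⟨finSigmaFinEquiv ⟨i, j⟩, c⟩ : Fin (∑ x, l x)).1 =
      (finSigmaFinEquiv (n := fun i => ∑ j, l (finSigmaFinEquiv ⟨i, j⟩))
        ⟨i, finSigmaFinEquiv (n := fun j => l (finSigmaFinEquiv ⟨i, j⟩)) ⟨j, c⟩⟩).1 := by
  rw [pos_eq, pos_eq, pos_eq, ← add_assoc]
  congr 1
  rw [← finSigmaFinEquiv.sum_comp (fun a => if a < finSigmaFinEquiv ⟨i, j⟩ then l a else 0),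
    Fintype.sum_sigma]
  have h : (∑ b, if b < j then l (finSigmaFinEquiv ⟨i, b⟩) else 0) =
      ∑ a, if h : a = i then
        (∑ b : Fin (k a), if (b : ℕ) < j then l (finSigmaFinEquiv ⟨a, b⟩) else 0) else 0 := by
    symm
    refine (Finset.sum_eq_single i ?_ ?_).trans ?_
    · intro a _ ha
      simp [ha]
    · simp
    · simp
  rw [h, ← Finset.sum_add_distrib]
  refine Finset.sum_congr rfl fun a _ => ?_
  simp only [pos_lt_iff]
  rcases lt_trichotomy a i with h3 | h3 | h3
  · simp [h3, h3.ne]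
  · simp [h3]
  · simp [h3.not_gt, h3.ne']

/-- The free symmetric operad on a non-symmetric operad `Q`: `LQ(n) = Q(n) × Σₙ`, the symmetric
group acts by right multiplication, and
`Γ((q, σ); (r₁, τ₁), …, (rₙ, τₙ)) = (Γ(q; r_{σ⁻¹1}, …, r_{σ⁻¹n}), σ⟨k₁, …, kₙ⟩ ∘ (τ₁ ⊕ ⋯ ⊕ τₙ))`
when `rᵢ` has arity `kᵢ`. -/
def L (Q : NSOperad) : SymmOperad where
  Op n := Q.Op n × Equiv.Perm (Fin n)
  one := (Q.one, 1)
  comp {n} p {k} r :=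
    (castOp (sum_comp_symm p.2 k) (Q.comp p.1 (fun i => (r (p.2.symm i)).1)),
      compPerm p.2 (fun i => (r i).2))
  one_comp {k} q := by
    refine total_pair_ext (q := (q 0).1) (τ := (q 0).2)
      ((total_castOp _ _).trans (Q.one_comp fun i => (q i).1)) ?_
    intro x y hxy
    obtain ⟨i, j, rfl⟩ := exists_pos x
    obtain rfl : i = 0 := Subsingleton.elim _ _
    rw [finSigmaFinEquiv_one] at hxy
    obtain rfl : j = y := Fin.ext hxy
    rw [compPerm_apply _ _ 0 j ((q 0).2 j) rfl]
    exact finSigmaFinEquiv_one _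
  comp_one {n} p := by
    refine total_pair_ext (q := p.1) (τ := p.2) ((total_castOp _ _).trans (Q.comp_one p.1)) ?_
    intro x y hxy
    obtain ⟨i, j, rfl⟩ := exists_pos x
    have hpos : ∀ (i : Fin n) (j : Fin 1),
        (finSigmaFinEquiv (n := fun _ : Fin n => 1) ⟨i, j⟩).1 = i := by
      intro i j
      rw [finSigmaFinEquiv_apply]
      simp
    rw [hpos] at hxy
    obtain rfl : i = y := Fin.ext hxy
    exact (compPerm_apply p.2 (k := fun _ => 1) (fun _ => 1) i j j rfl).trans (hpos _ _)
  assoc {n} p {k} q {l} r := by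
    refine total_pair_ext ?_ ?_
    · refine (total_castOp _ _).trans (Eq.trans ?_ (total_castOp _ _).symm)
      refine (Q.comp_congr (total_castOp _ _) (k' := fun x => l ((compPerm p.2 fun i => (q i).2).symm
        (Fin.cast (sum_comp_symm p.2 k) x))) (q' := fun x => (r ((compPerm p.2 fun i => (q i).2).symm
        (Fin.cast (sum_comp_symm p.2 k) x))).1) ?_).trans ?_
      · intro x y hxy
        refine total_apply_congr (fun x => (r x).1) (congrArg _ (Fin.ext hxy))
      · refine (Q.assoc _ _ _).trans ?_
        refine Q.comp_congr rfl ?_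
        intro i i' hi
        obtain rfl : i = i' := Fin.ext hi
        refine Eq.trans ?_ (total_castOp _ _).symm
        refine Q.comp_congr rfl ?_
        intro j j' hj
        obtain rfl : j = j' := Fin.ext hj
        exact total_apply_congr (fun x => (r x).1)
          (compPerm_symm_apply p.2 (fun i => (q i).2) i j)
    · intro x y hxy
      obtain ⟨z, c, rfl⟩ := exists_pos x
      obtain ⟨i, j, rfl⟩ := exists_pos z
      have hy : y = finSigmaFinEquiv ⟨i, finSigmaFinEquiv ⟨j, c⟩⟩ :=
        Fin.ext (hxy.symm.trans (pos_assoc l i j c))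
      subst hy
      have e1 := compPerm_apply_cast p.2 (fun i => (q i).2) i j
      have e2 := compPerm_apply_cast (compPerm p.2 fun i => (q i).2) (fun x => (r x).2)
        (finSigmaFinEquiv ⟨i, j⟩) c
      have e3 := compPerm_apply_cast (q i).2 (fun j => (r (finSigmaFinEquiv ⟨i, j⟩)).2) j c
      have e4 := compPerm_apply_cast p.2 (fun i => compPerm (q i).2
        (fun j => (r (finSigmaFinEquiv ⟨i, j⟩)).2)) i (finSigmaFinEquiv ⟨j, c⟩)
      refine e2.trans (Eq.trans ?_ e4.symm)
      set ϖ := compPerm p.2 fun i => (q i).2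
      have hm : ϖ.symm (Fin.cast (sum_comp_symm p.2 k)
          (finSigmaFinEquiv (n := fun i => k (p.2.symm i))
            ⟨p.2 i, Fin.cast (congrArg k (p.2.symm_apply_apply i).symm) ((q i).2 j)⟩)) =
          finSigmaFinEquiv ⟨i, j⟩ :=
        (Equiv.symm_apply_eq _).2 (Fin.ext e1.symm)
      refine (pos_congr' (sum_comp_symm p.2 k).symm
        (k' := fun x => l (ϖ.symm (Fin.cast (sum_comp_symm p.2 k) x))) ?_ e1
        (j' := Fin.cast (congrArg l hm.symm) ((r (finSigmaFinEquiv ⟨i, j⟩)).2 c)) rfl).trans ?_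
      · intro a b hab
        exact congrArg (fun x => l (ϖ.symm x)) (Fin.ext hab)
      refine (pos_assoc _ _ _ _).trans ?_
      refine pos_congr ?_ rfl ?_
      · intro a
        refine Eq.trans ?_ (Equiv.sum_comp (q (p.2.symm a)).2.symm
          (fun b => l (finSigmaFinEquiv ⟨p.2.symm a, b⟩)))
        exact Finset.sum_congr rfl fun b _ =>
          congrArg l (compPerm_symm_apply p.2 (fun i => (q i).2) a b)
      · refine Eq.trans ?_ e3.symm
        refine pos_congr' (congrArg k (p.2.symm_apply_apply i)) ?_ rfl rfl
        intro a b hab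
        refine congrArg l ((compPerm_symm_apply p.2 (fun i => (q i).2) _ a).trans (Fin.ext ?_))
        exact pos_congr (fun _ => rfl) (p.2.symm_apply_apply i)
          (perm_symm_val_congr (fun i => (q i).2) (p.2.symm_apply_apply i) hab)
  perm p σ := (p.1, p.2 * σ)
  perm_one p := by simp
  perm_mul p σ τ := by simp [mul_assoc]
  comp_perm {n} p {k} q τ := by
    refine Prod.ext rfl ?_
    ext x
    obtain ⟨i, j, rfl⟩ := exists_pos x
    simp [compPerm, sumPerm_apply]
  perm_comp {n} p σ {k} q := by
    refine eq_of_heq (Sigma.mk.inj (total_pair_ext (Op := Q.Op) ?_ ?_)).2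
    · rw [castOp_fst]
      exact ((total_castOp _ _).trans (total_castOp _ _).symm).trans (total_castOp _ _).symm
    · intro x y hxy
      obtain rfl : x = y := Fin.ext hxy
      obtain ⟨i, j, rfl⟩ := exists_pos x
      have e1 := blockPerm_apply σ k i j
        (Fin.cast (congrArg k (σ.symm_apply_apply i).symm) j) rfl
      have e2 := compPerm_apply_cast p.2 (fun i => (q (σ.symm i)).2) (σ i)
        (Fin.cast (congrArg k (σ.symm_apply_apply i).symm) j)
      refine (compPerm_apply_cast (p.2 * σ) (fun i => (q i).2) i j).trans ?_
      refine Eq.trans ?_ (castOp_snd (sum_comp_symm σ k) _ _ _ e1.symm).symm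
      refine Eq.trans ?_ e2.symm
      exact pos_congr (fun _ => rfl) rfl
        (perm_val_congr (fun i => (q i).2) (σ.symm_apply_apply i).symm rfl)

/-! ### Categorical operads, and the chaotic-category functor `E` -/

/-- A categorical operad: a symmetric operad in the category of (small) categories with the
cartesian product.  The identities are equalities of functors; they are stated on morphisms, as
equalities in the set `Σ n, Arrow (Obj n)` of all morphisms of all the categories `Obj n`.  They
contain the equalities on objects, since an arrow determines its source and target. -/
structure CatOperad where
  Obj : ℕ → Type
  [cat : ∀ n, Category.{0} (Obj n)]
  one : Obj 1
  comp : ∀ {n : ℕ} (k : Fin n → ℕ), Obj n × (∀ i, Obj (k i)) ⥤ Obj (∑ i, k i)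
  perm : ∀ {n : ℕ}, Equiv.Perm (Fin n) → (Obj n ⥤ Obj n)
  one_comp : ∀ {k : Fin 1 → ℕ} {q q' : ∀ i, Obj (k i)} (g : ∀ i, q i ⟶ q' i),
    (⟨_, Arrow.mk ((comp k).map ((𝟙 one, g) : (one, q) ⟶ (one, q')))⟩ : Σ n, Arrow (Obj n)) =
      ⟨k 0, Arrow.mk (g 0)⟩
  comp_one : ∀ {n : ℕ} {p p' : Obj n} (f : p ⟶ p'),
    (⟨_, Arrow.mk ((comp (fun _ : Fin n => 1)).map
      ((f, fun _ => 𝟙 one) : (p, fun _ => one) ⟶ (p', fun _ => one)))⟩ : Σ n, Arrow (Obj n)) =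
      ⟨n, Arrow.mk f⟩
  assoc : ∀ {n : ℕ} {p p' : Obj n} (f : p ⟶ p') {k : Fin n → ℕ} {q q' : ∀ i, Obj (k i)}
    (g : ∀ i, q i ⟶ q' i) {l : Fin (∑ i, k i) → ℕ} {r r' : ∀ x, Obj (l x)}
    (h : ∀ x, r x ⟶ r' x),
    (⟨_, Arrow.mk ((comp l).map
      (((comp k).map ((f, g) : (p, q) ⟶ (p', q')), h) :
        ((comp k).obj (p, q), r) ⟶ ((comp k).obj (p', q'), r')))⟩ : Σ n, Arrow (Obj n)) =
      ⟨_, Arrow.mk ((comp (fun i => ∑ j, l (finSigmaFinEquiv ⟨i, j⟩))).map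
        ((f, fun i => (comp (fun j => l (finSigmaFinEquiv ⟨i, j⟩))).map
          ((g i, fun j => h (finSigmaFinEquiv ⟨i, j⟩)) :
            (q i, fun j => r (finSigmaFinEquiv ⟨i, j⟩)) ⟶
              (q' i, fun j => r' (finSigmaFinEquiv ⟨i, j⟩)))) :
          (p, fun i => (comp _).obj (q i, fun j => r (finSigmaFinEquiv ⟨i, j⟩))) ⟶
            (p', fun i => (comp _).obj (q' i, fun j => r' (finSigmaFinEquiv ⟨i, j⟩)))))⟩
  perm_one : ∀ n : ℕ, perm (1 : Equiv.Perm (Fin n)) = 𝟭 (Obj n)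
  perm_mul : ∀ {n : ℕ} (σ τ : Equiv.Perm (Fin n)), perm (σ * τ) = perm σ ⋙ perm τ
  comp_perm : ∀ {n : ℕ} {p p' : Obj n} (f : p ⟶ p') {k : Fin n → ℕ} {q q' : ∀ i, Obj (k i)}
    (g : ∀ i, q i ⟶ q' i) (τ : ∀ i, Equiv.Perm (Fin (k i))),
    Arrow.mk ((comp k).map ((f, fun i => (perm (τ i)).map (g i)) :
      (p, fun i => (perm (τ i)).obj (q i)) ⟶ (p', fun i => (perm (τ i)).obj (q' i)))) =
      Arrow.mk ((perm (sumPerm τ)).map ((comp k).map ((f, g) : (p, q) ⟶ (p', q'))))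
  perm_comp : ∀ {n : ℕ} {p p' : Obj n} (f : p ⟶ p') (σ : Equiv.Perm (Fin n)) {k : Fin n → ℕ}
    {q q' : ∀ i, Obj (k i)} (g : ∀ i, q i ⟶ q' i),
    Arrow.mk ((comp k).map (((perm σ).map f, g) : ((perm σ).obj p, q) ⟶ ((perm σ).obj p', q'))) =
      (perm (blockPerm σ k)).mapArrow.obj
        (castOp (Op := fun n => Arrow (Obj n)) (sum_comp_symm σ k)
          (Arrow.mk ((comp (fun i => k (σ.symm i))).map
            ((f, fun i => g (σ.symm i)) :
              (p, fun i => q (σ.symm i)) ⟶ (p', fun i => q' (σ.symm i))))))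

attribute [instance] CatOperad.cat

theorem total_arrow_ext {Op : ℕ → Type} {m n : ℕ} {a b : Codiscrete (Op m)}
    {a' b' : Codiscrete (Op n)} (f : a ⟶ b) (f' : a' ⟶ b')
    (ha : (⟨m, a.as⟩ : Σ n, Op n) = ⟨n, a'.as⟩) (hb : (⟨m, b.as⟩ : Σ n, Op n) = ⟨n, b'.as⟩) :
    (⟨m, Arrow.mk f⟩ : Σ n, Arrow (Codiscrete (Op n))) = ⟨n, Arrow.mk f'⟩ := by
  obtain ⟨a⟩ := a
  obtain ⟨b⟩ := b
  obtain ⟨a'⟩ := a'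
  obtain ⟨b'⟩ := b'
  dsimp only at ha hb
  cases ha
  cases hb
  rfl

theorem arrow_ext {A : Type} {a b a' b' : Codiscrete A} (f : a ⟶ b) (f' : a' ⟶ b')
    (ha : a.as = a'.as) (hb : b.as = b'.as) : Arrow.mk f = Arrow.mk f' := by
  obtain ⟨a⟩ := a
  obtain ⟨b⟩ := b
  obtain ⟨a'⟩ := a'
  obtain ⟨b'⟩ := b'
  obtain rfl : a = a' := ha
  obtain rfl : b = b' := hb
  rfl

theorem castOp_arrow {Op : ℕ → Type} {m n : ℕ} (h : m = n) {a b : Codiscrete (Op m)}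
    (f : a ⟶ b) :
    castOp (Op := fun n => Arrow (Codiscrete (Op n))) h (Arrow.mk f) =
      Arrow.mk (Codiscrete.iso (Codiscrete.mk (castOp h a.as)) (Codiscrete.mk (castOp h b.as))).hom := by
  subst h
  rfl

/-- The categorical operad `EP` of a symmetric operad of sets `P`: degreewise, `E` turns a set `X`
into the category with set of objects `X` and exactly one morphism `x ⟶ y` for all `x` and `y`. -/
def E (P : SymmOperad) : CatOperad where
  Obj n := Codiscrete (P.Op n)
  one := ⟨P.one⟩
  comp k := Codiscrete.functor fun x => P.comp x.1.as fun i => (x.2 i).as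
  perm σ := Codiscrete.functor fun p => P.perm p.as σ
  one_comp g := total_arrow_ext _ _ (P.one_comp _) (P.one_comp _)
  comp_one f := total_arrow_ext _ _ (P.comp_one _) (P.comp_one _)
  assoc f _ _ _ g _ _ _ h := total_arrow_ext _ _ (P.assoc _ _ _) (P.assoc _ _ _)
  perm_one n := CategoryTheory.Functor.ext
    (fun p => Codiscrete.ext (P.perm_one p.as)) (fun _ _ _ => rfl)
  perm_mul σ τ := CategoryTheory.Functor.ext
    (fun p => Codiscrete.ext (P.perm_mul p.as σ τ)) (fun _ _ _ => rfl)
  comp_perm f _ _ _ g τ := arrow_ext _ _ (P.comp_perm _ _ _) (P.comp_perm _ _ _)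
  perm_comp f σ _ _ _ g := by
    rw [castOp_arrow]
    exact arrow_ext _ _ (P.perm_comp _ _ _) (P.perm_comp _ _ _)

/-- The categorical operad `Y = ELZ`. -/
def Y : CatOperad := E (L Z)

/-- The object `((β, S), σ)` of `Y(n)`, where `(β, S)` is given as the tree `t`. -/
def yObj {n : ℕ} (t : ZTree) (h : t.arity = n) (σ : Equiv.Perm (Fin n)) : Y.Obj n :=
  Codiscrete.mk (⟨t, h⟩, σ)

/-- The unique morphism between two objects of `Y(n)`. -/
def yHom {n : ℕ} (p q : Y.Obj n) : p ⟶ q := (Codiscrete.iso _ _).hom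

/-! ### Algebras over a categorical operad -/

universe v u

/-- The structure of an algebra over the categorical operad `P` on the category `C`: action functors
`P(n) × Cⁿ ⥤ C` which are unital, associative and equivariant, where `p · σ` acts on
`(x₁, …, xₙ)` as `p` acts on `(x_{σ⁻¹1}, …, x_{σ⁻¹n})`.  The identities are equalities of functors,
again stated on morphisms. -/
structure OperadAlgebra (P : CatOperad) (C : Type u) [Category.{v} C] where
  act : ∀ n : ℕ, P.Obj n × (Fin n → C) ⥤ C
  one_act : ∀ {x y : Fin 1 → C} (h : ∀ i, x i ⟶ y i),
    Arrow.mk ((act 1).map ((𝟙 P.one, h) : (P.one, x) ⟶ (P.one, y))) = Arrow.mk (h 0)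
  comp_act : ∀ {n : ℕ} {p p' : P.Obj n} (f : p ⟶ p') {k : Fin n → ℕ} {q q' : ∀ i, P.Obj (k i)}
    (g : ∀ i, q i ⟶ q' i) {x y : Fin (∑ i, k i) → C} (h : ∀ i, x i ⟶ y i),
    Arrow.mk ((act (∑ i, k i)).map
      (((P.comp k).map ((f, g) : (p, q) ⟶ (p', q')), h) :
        ((P.comp k).obj (p, q), x) ⟶ ((P.comp k).obj (p', q'), y))) =
      Arrow.mk ((act n).map
        ((f, fun i => (act (k i)).map
          ((g i, fun j => h (finSigmaFinEquiv ⟨i, j⟩)) :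
            (q i, fun j => x (finSigmaFinEquiv ⟨i, j⟩)) ⟶
              (q' i, fun j => y (finSigmaFinEquiv ⟨i, j⟩)))) :
          (p, fun i => (act (k i)).obj (q i, fun j => x (finSigmaFinEquiv ⟨i, j⟩))) ⟶
            (p', fun i => (act (k i)).obj (q' i, fun j => y (finSigmaFinEquiv ⟨i, j⟩)))))
  perm_act : ∀ {n : ℕ} {p p' : P.Obj n} (f : p ⟶ p') (σ : Equiv.Perm (Fin n)) {x y : Fin n → C}
    (h : ∀ i, x i ⟶ y i),
    Arrow.mk ((act n).map
      (((P.perm σ).map f, h) : ((P.perm σ).obj p, x) ⟶ ((P.perm σ).obj p', y))) =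
      Arrow.mk ((act n).map
        ((f, fun i => h (σ.symm i)) : (p, fun i => x (σ.symm i)) ⟶ (p', fun i => y (σ.symm i))))

/-- A functor is a map of `P`-algebras if it commutes strictly with the action functors. -/
structure OperadAlgebra.IsMap {P : CatOperad} {C D : Type u} [Category.{v} C] [Category.{v} D]
    (A : OperadAlgebra P C) (B : OperadAlgebra P D) (F : C ⥤ D) : Prop where
  map_act : ∀ {n : ℕ} {p p' : P.Obj n} (f : p ⟶ p') {x y : Fin n → C} (h : ∀ i, x i ⟶ y i),
    Arrow.mk (F.map ((A.act n).map ((f, h) : (p, x) ⟶ (p', y)))) =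
      Arrow.mk ((B.act n).map
        ((f, fun i => F.map (h i)) : (p, fun i => F.obj (x i)) ⟶ (p', fun i => F.obj (y i))))

/-- A (small) category with the structure of a `P`-algebra. -/
structure OperadAlgCat (P : CatOperad) where
  carrier : Type u
  [cat : Category.{v} carrier]
  alg : OperadAlgebra P carrier

attribute [instance] OperadAlgCat.cat

/-- Maps of `P`-algebras. -/
@[ext]
structure OperadAlgCat.Hom {P : CatOperad} (A B : OperadAlgCat.{v, u} P) where
  functor : A.carrier ⥤ B.carrier
  isMap : A.alg.IsMap B.alg functor

theorem OperadAlgebra.IsMap.comp {P : CatOperad} {C D K : Type u} [Category.{v} C]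
    [Category.{v} D] [Category.{v} K] {A : OperadAlgebra P C} {B : OperadAlgebra P D}
    {B' : OperadAlgebra P K} {F : C ⥤ D} {G : D ⥤ K} (hF : A.IsMap B F) (hG : B.IsMap B' G) :
    A.IsMap B' (F ⋙ G) where
  map_act f _ _ h :=
    (congrArg G.mapArrow.obj (hF.map_act f h)).trans (hG.map_act f fun i => F.map (h i))

/-- The category of `P`-algebras. -/
instance (P : CatOperad) : Category (OperadAlgCat.{v, u} P) where
  Hom := OperadAlgCat.Hom
  id A := ⟨𝟭 _, ⟨fun _ _ _ _ => rfl⟩⟩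
  comp F G := ⟨F.functor ⋙ G.functor, F.isMap.comp G.isMap⟩

/-- The functor that forgets the algebra structure. -/
def OperadAlgCat.forget (P : CatOperad) : OperadAlgCat.{v, u} P ⥤ Cat.{v, u} where
  obj A := Cat.of A.carrier
  map F := F.functor.toCatHom

/-! ### Symmetric monoidal categories and strict maps -/

open MonoidalCategory

/-- A symmetric monoidal structure on the category `C`. -/
structure SymmMonStructure (C : Type u) [Category.{v} C] where
  [monoidal : MonoidalCategory.{v} C]
  [symmetric : SymmetricCategory.{v} C]

/-- A functor is a strict map of symmetric monoidal categories if it preserves the unit, the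
tensor product and the structure isomorphisms on the nose. -/
structure IsStrictSymmMon {C D : Type u} [Category.{v} C] [Category.{v} D]
    [MonoidalCategory.{v} C] [SymmetricCategory.{v} C]
    [MonoidalCategory.{v} D] [SymmetricCategory.{v} D] (F : C ⥤ D) : Prop where
  unit : F.obj (𝟙_ C) = 𝟙_ D
  tensor : ∀ {a a' b b' : C} (f : a ⟶ a') (g : b ⟶ b'),
    Arrow.mk (F.map (f ⊗ₘ g)) = Arrow.mk (F.map f ⊗ₘ F.map g)
  associator : ∀ a b c : C,
    Arrow.mk (F.map (α_ a b c).hom) = Arrow.mk (α_ (F.obj a) (F.obj b) (F.obj c)).hom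
  leftUnitor : ∀ a : C, Arrow.mk (F.map (λ_ a).hom) = Arrow.mk (λ_ (F.obj a)).hom
  rightUnitor : ∀ a : C, Arrow.mk (F.map (ρ_ a).hom) = Arrow.mk (ρ_ (F.obj a)).hom
  braiding : ∀ a b : C, Arrow.mk (F.map (β_ a b).hom) = Arrow.mk (β_ (F.obj a) (F.obj b)).hom

/-- A (small) symmetric monoidal category. -/
structure SymmMonCat where
  carrier : Type u
  [cat : Category.{v} carrier]
  str : SymmMonStructure carrier

attribute [instance] SymmMonCat.cat

instance (A : SymmMonCat.{v, u}) : MonoidalCategory.{v} A.carrier := A.str.monoidal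

instance (A : SymmMonCat.{v, u}) : SymmetricCategory.{v} A.carrier := A.str.symmetric

/-- Strict maps of symmetric monoidal categories. -/
@[ext]
structure SymmMonCat.Hom (A B : SymmMonCat.{v, u}) where
  functor : A.carrier ⥤ B.carrier
  isStrict : IsStrictSymmMon functor

theorem IsStrictSymmMon.id (C : Type u) [Category.{v} C] [MonoidalCategory.{v} C]
    [SymmetricCategory.{v} C] : IsStrictSymmMon (𝟭 C) where
  unit := rfl
  tensor _ _ := rfl
  associator _ _ _ := rfl
  leftUnitor _ := rfl
  rightUnitor _ := rfl
  braiding _ _ := rfl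

theorem IsStrictSymmMon.comp {C D K : Type u} [Category.{v} C] [Category.{v} D] [Category.{v} K]
    [MonoidalCategory.{v} C] [SymmetricCategory.{v} C]
    [MonoidalCategory.{v} D] [SymmetricCategory.{v} D]
    [MonoidalCategory.{v} K] [SymmetricCategory.{v} K] {F : C ⥤ D} {G : D ⥤ K}
    (hF : IsStrictSymmMon F) (hG : IsStrictSymmMon G) : IsStrictSymmMon (F ⋙ G) where
  unit := (congrArg G.obj hF.unit).trans hG.unit
  tensor f g := (congrArg G.mapArrow.obj (hF.tensor f g)).trans (hG.tensor _ _)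
  associator a b c := (congrArg G.mapArrow.obj (hF.associator a b c)).trans (hG.associator _ _ _)
  leftUnitor a := (congrArg G.mapArrow.obj (hF.leftUnitor a)).trans (hG.leftUnitor _)
  rightUnitor a := (congrArg G.mapArrow.obj (hF.rightUnitor a)).trans (hG.rightUnitor _)
  braiding a b := (congrArg G.mapArrow.obj (hF.braiding a b)).trans (hG.braiding _ _)

/-- The category of symmetric monoidal categories and strict maps. -/
instance : Category SymmMonCat.{v, u} where
  Hom := SymmMonCat.Hom
  id A := ⟨𝟭 _, IsStrictSymmMon.id _⟩
  comp F G := ⟨F.functor ⋙ G.functor, F.isStrict.comp G.isStrict⟩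

/-- The functor that forgets the symmetric monoidal structure. -/
def SymmMonCat.forget : SymmMonCat.{v, u} ⥤ Cat.{v, u} where
  obj A := Cat.of A.carrier
  map F := F.functor.toCatHom

/-! ### The correspondence -/

/-- The symmetric monoidal structure of `C` is the one that is read off from the `Y`-algebra
structure `A`: the unit object and the tensor product are the actions of the generators
`(1, ∅)` and `((1,1), {1,2})` of `Z`, and the structure isomorphisms are the images of the unique
morphisms of `Y` between the operations that they relate. -/
structure IsReadOff {C : Type u} [Category.{v} C] [MonoidalCategory.{v} C]
    [SymmetricCategory.{v} C] (A : OperadAlgebra Y C) : Prop where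
  unit : ∀ x : Fin 0 → C, 𝟙_ C = (A.act 0).obj (yObj .unit rfl 1, x)
  tensor : ∀ {x y : Fin 2 → C} (h : ∀ i, x i ⟶ y i),
    Arrow.mk (h 0 ⊗ₘ h 1) = Arrow.mk ((A.act 2).map
      ((𝟙 _, h) : (yObj (.node .var .var) rfl 1, x) ⟶ (yObj (.node .var .var) rfl 1, y)))
  associator : ∀ x : Fin 3 → C,
    Arrow.mk (α_ (x 0) (x 1) (x 2)).hom = Arrow.mk ((A.act 3).map
      ((yHom _ _, 𝟙 x) : (yObj (.node (.node .var .var) .var) rfl 1, x) ⟶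
        (yObj (.node .var (.node .var .var)) rfl 1, x)))
  rightUnitor : ∀ x : Fin 1 → C,
    Arrow.mk (ρ_ (x 0)).hom = Arrow.mk ((A.act 1).map
      ((yHom _ _, 𝟙 x) : (yObj (.node .var .unit) rfl 1, x) ⟶ (yObj .var rfl 1, x)))
  leftUnitor : ∀ x : Fin 1 → C,
    Arrow.mk (λ_ (x 0)).hom = Arrow.mk ((A.act 1).map
      ((yHom _ _, 𝟙 x) : (yObj (.node .unit .var) rfl 1, x) ⟶ (yObj .var rfl 1, x)))
  braiding : ∀ x : Fin 2 → C,
    Arrow.mk (β_ (x 0) (x 1)).hom = Arrow.mk ((A.act 2).map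
      ((yHom _ _, 𝟙 x) : (yObj (.node .var .var) rfl 1, x) ⟶
        (yObj (n := 2) (.node .var .var) rfl (Equiv.swap 0 1), x)))

/-- The symmetric monoidal structure `M` and the `Y`-algebra structure `A` on `C` correspond to each
other. -/
def Corresponds {C : Type u} [Category.{v} C] (M : SymmMonStructure C) (A : OperadAlgebra Y C) :
    Prop :=
  letI := M.monoidal
  letI := M.symmetric
  IsReadOff A

end ELZ

open CategoryTheory ELZ

universe v u

namespace ELZ

open CategoryTheory MonoidalCategory BraidedCategory


/-! ### Words with labelled variables and formal structure isomorphisms -/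

/-! An object of `Y.Obj n` is the same thing as a parenthesized word in the unit and the variables
`1, …, n` in which each variable occurs exactly once. Operadic composition is substitution of words,
and the symmetric groups rename variables (`yWord_comp`, `yWord_perm`). Since `Y.Obj n` has exactly
one morphism between any two objects, an action of `Y` is a coherent choice of natural isomorphisms
between all these words. The theorem is therefore a form of Mac Lane's coherence theorem.

From a symmetric monoidal structure to an action: words are evaluated with the unit and the tensor
product, and the morphism `p ⟶ p'` acts by a formal composite of structure isomorphisms from the
word of `p` to that of `p'`. Such a composite exists because both words have the same labels
(`FHom.exists_of_perm`). Its value does not depend on the choice, by coherence for words without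
repeated variables (`FHom.eval_eq`).

Coherence is proved as follows. The tensor product is itself a symmetric monoidal functor of two
variables, so two formal isomorphisms that agree at the families `y` and `z` agree at `y ⊗ z`
(`FHom.eval_eq_of_tensor`). Every finite family is, up to isomorphism, a tensor product of families
with at most one entry different from the unit. For such a family each word without repetitions has
a canonical isomorphism to the unit or to the exceptional object, and all formal isomorphisms
commute with these (`Reduces.hom_comp`).

From an action to a symmetric monoidal structure: the data are read off from the generating
operations. Each axiom holds because both of its sides are images of the unique morphism of `Y`
between the same two operations. The relation `OperadAlgebra.Realizes` makes this precise without
comparing arities: it records that an arrow is the action of a morphism between two labelled words.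
It determines the arrow (`Realizes.unique`) and is stable under composition, inversion and
substitution.

The two constructions are inverse to each other: the data of a symmetric monoidal structure are
determined by the action from which they are read off (`SymmMonStructure.eq_of_isOf`), and
conversely the read-off data realize every formal isomorphism and hence determine the action
(`ReadOff.eq_symmMonAlgebra`). A functor that preserves the generating data strictly preserves
values of words and of formal isomorphisms, so the strict maps are the same on both sides. -/

/-- Parenthesized words in the unit and in variables labelled by `ι`. -/
inductive FTree (ι : Type) : Type
  | unit : FTree ι
  | var : ι → FTree ι
  | node : FTree ι → FTree ι → FTree ι

namespace FTree

variable {ι κ : Type}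

/-- The labels that occur in a word, from left to right. -/
def leaves : FTree ι → List ι
  | .unit => []
  | .var i => [i]
  | .node t u => t.leaves ++ u.leaves

/-- Substitution of words for the variables. -/
def bind : FTree ι → (ι → FTree κ) → FTree κ
  | .unit, _ => .unit
  | .var i, s => s i
  | .node t u, s => .node (t.bind s) (u.bind s)

/-- The word that consists of the given variables, parenthesized from the right. -/
def ofList : List ι → FTree ι
  | [] => .unit
  | i :: l => .node (.var i) (ofList l)

end FTree

/-- Formal composites of the structure isomorphisms of a symmetric monoidal category. -/
inductive FHom {ι : Type} : FTree ι → FTree ι → Type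
  | refl (T) : FHom T T
  | symm {T U} : FHom T U → FHom U T
  | trans {T U V} : FHom T U → FHom U V → FHom T V
  | tensor {T T' U U'} : FHom T T' → FHom U U' → FHom (.node T U) (.node T' U')
  | assoc (T U V) : FHom (.node (.node T U) V) (.node T (.node U V))
  | lUnit (T) : FHom (.node .unit T) T
  | rUnit (T) : FHom (.node T .unit) T
  | braid (T U) : FHom (.node T U) (.node U T)

/-- Needed to carry the absence of repeated variables along a formal isomorphism. -/
theorem FHom.leaves_perm {ι : Type} {T T' : FTree ι} (f : FHom T T') :
    T.leaves.Perm T'.leaves := by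
  induction f with
  | refl T => exact .refl _
  | symm _ ih => exact ih.symm
  | trans _ _ ih ih' => exact ih.trans ih'
  | tensor _ _ ih ih' => exact ih.append ih'
  | assoc T U V => simp [FTree.leaves]
  | lUnit T => simp [FTree.leaves]
  | rUnit T => simp [FTree.leaves]
  | braid T U => exact List.perm_append_comm

theorem FHom.exists_append {ι : Type} (l m : List ι) :
    Nonempty (FHom (.node (.ofList l) (.ofList m)) (FTree.ofList (l ++ m))) := by
  induction l with
  | nil => exact ⟨.lUnit _⟩
  | cons i l ih =>
    obtain ⟨f⟩ := ih
    exact ⟨.trans (.assoc _ _ _) (.tensor (.refl _) f)⟩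

theorem FHom.exists_ofList_leaves {ι : Type} (T : FTree ι) :
    Nonempty (FHom T (.ofList T.leaves)) := by
  induction T with
  | unit => exact ⟨.refl _⟩
  | var i => exact ⟨.symm (.rUnit _)⟩
  | node T U ihT ihU =>
    obtain ⟨f⟩ := ihT
    obtain ⟨g⟩ := ihU
    obtain ⟨h⟩ := FHom.exists_append T.leaves U.leaves
    exact ⟨.trans (.tensor f g) h⟩

theorem FHom.exists_of_list_perm {ι : Type} {l m : List ι} (h : l.Perm m) :
    Nonempty (FHom (FTree.ofList l) (FTree.ofList m)) := by
  induction h with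
  | nil => exact ⟨.refl _⟩
  | cons i _ ih =>
    obtain ⟨f⟩ := ih
    exact ⟨.tensor (.refl _) f⟩
  | swap i j l =>
    exact ⟨.trans (.symm (.assoc _ _ _)) (.trans (.tensor (.braid _ _) (.refl _)) (.assoc _ _ _))⟩
  | trans _ _ ih ih' =>
    obtain ⟨f⟩ := ih
    obtain ⟨g⟩ := ih'
    exact ⟨.trans f g⟩

/-- Both words are isomorphic to the right-parenthesized words of their lists of labels, and these
are connected by transpositions of neighbours. -/
theorem FHom.exists_of_perm {ι : Type} {T T' : FTree ι} (h : T.leaves.Perm T'.leaves) :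
    Nonempty (FHom T T') := by
  obtain ⟨f⟩ := FHom.exists_ofList_leaves T
  obtain ⟨g⟩ := FHom.exists_of_list_perm h
  obtain ⟨k⟩ := FHom.exists_ofList_leaves T'
  exact ⟨.trans f (.trans g (.symm k))⟩

/-! ### Values of words and of formal isomorphisms -/

section Eval

variable {ι : Type} {C : Type u} [Category.{v} C] [MonoidalCategory C]

/-- The value of a word at a family of objects. -/
def FTree.eval : FTree ι → (ι → C) → C
  | .unit, _ => 𝟙_ C
  | .var i, x => x i
  | .node T U, x => T.eval x ⊗ U.eval x

/-- The value of a word at a family of morphisms. -/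
def FTree.evalMap : (T : FTree ι) → {x y : ι → C} → (∀ i, x i ⟶ y i) → (T.eval x ⟶ T.eval y)
  | .unit, _, _, _ => 𝟙 (𝟙_ C)
  | .var i, _, _, h => h i
  | .node T U, _, _, h => T.evalMap h ⊗ₘ U.evalMap h

theorem FTree.evalMap_id (T : FTree ι) (x : ι → C) : T.evalMap (fun i => 𝟙 (x i)) = 𝟙 _ := by
  induction T with
  | unit => rfl
  | var i => rfl
  | node T U ihT ihU => simp only [FTree.evalMap, ihT, ihU, id_tensorHom_id]; rfl

theorem FTree.evalMap_comp (T : FTree ι) {x y z : ι → C} (h : ∀ i, x i ⟶ y i)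
    (k : ∀ i, y i ⟶ z i) : T.evalMap (fun i => h i ≫ k i) = T.evalMap h ≫ T.evalMap k := by
  induction T with
  | unit => exact (Category.id_comp _).symm
  | var i => rfl
  | node T U ihT ihU =>
    simp only [FTree.evalMap, ihT, ihU]
    exact (tensorHom_comp_tensorHom _ _ _ _).symm

/-- The square of `FHom.tensorIso_naturality` read backwards, for the case of a formal inverse. -/
theorem tensor_inv_comp_eq {A A' B B' E E' : C} (a : A ≅ A') (b : B ≅ B') (m : A ⊗ B ⟶ E)
    (m' : A' ⊗ B' ⟶ E') (c : E ≅ E') (h : (a.hom ⊗ₘ b.hom) ≫ m' = m ≫ c.hom) :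
    (a.inv ⊗ₘ b.inv) ≫ m = m' ≫ c.inv := by
  rw [Iso.eq_comp_inv, Category.assoc, ← h, tensorHom_comp_tensorHom_assoc]
  simp

variable [SymmetricCategory C]

/-- The value of a formal isomorphism at a family of objects. -/
def FHom.eval : {T T' : FTree ι} → FHom T T' → (x : ι → C) → (T.eval x ≅ T'.eval x)
  | _, _, .refl _, _ => Iso.refl _
  | _, _, .symm f, x => (f.eval x).symm
  | _, _, .trans f g, x => f.eval x ≪≫ g.eval x
  | _, _, .tensor f g, x => f.eval x ⊗ᵢ g.eval x
  | _, _, .assoc T U V, x => α_ (T.eval x) (U.eval x) (V.eval x)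
  | _, _, .lUnit T, x => λ_ (T.eval x)
  | _, _, .rUnit T, x => ρ_ (T.eval x)
  | _, _, .braid T U, x => β_ (T.eval x) (U.eval x)

theorem FHom.eval_naturality {T T' : FTree ι} (f : FHom T T') {x y : ι → C}
    (h : ∀ i, x i ⟶ y i) :
    (f.eval x).hom ≫ T'.evalMap h = T.evalMap h ≫ (f.eval y).hom := by
  induction f with
  | refl T => exact (Category.id_comp _).trans (Category.comp_id _).symm
  | symm f ih =>
    simp only [FHom.eval, Iso.symm_hom]
    rw [Iso.inv_comp_eq, ← Category.assoc, ih, Category.assoc, Iso.hom_inv_id, Category.comp_id]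
  | trans f g ih ih' =>
    simp only [FHom.eval, Iso.trans_hom, Category.assoc]
    rw [ih', reassoc_of% ih]
  | tensor f g ih ih' =>
    refine (tensorHom_comp_tensorHom _ _ _ _).trans ?_
    rw [ih, ih']
    exact (tensorHom_comp_tensorHom _ _ _ _).symm
  | assoc T U V => exact (associator_naturality _ _ _).symm
  | lUnit T =>
    refine (leftUnitor_naturality (T.evalMap h)).symm.trans ?_
    rw [← id_tensorHom]
    rfl
  | rUnit T =>
    refine (rightUnitor_naturality (T.evalMap h)).symm.trans ?_
    rw [← tensorHom_id]
    rfl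
  | braid T U => exact (braiding_naturality _ _).symm

end Eval

section Eval

variable {ι : Type} {C : Type u} [Category.{v} C] [MonoidalCategory C] [SymmetricCategory C]

/-! ### The tensor product is a symmetric monoidal functor -/

/-- The braiding of `A ⊗ A'` with `B ⊗ B'` splits into four elementary braidings. The one of `A'`
with `B` undoes the interchange made by `tensorμ`; this cancellation is where symmetry is used,
rather than just a braiding. -/
theorem braiding_tensorμ (A A' B B' : C) :
    ((β_ A B).hom ⊗ₘ (β_ A' B').hom) ≫ tensorμ B A B' A' =
      tensorμ A B A' B' ≫ (β_ (A ⊗ A') (B ⊗ B')).hom := by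
  dsimp only [tensorμ]
  simp only [braiding_tensor_left_hom, braiding_tensor_right_hom]
  symm
  calc
    _ = 𝟙 _ ⊗≫ A ◁ ((β_ B A').hom ≫ (β_ A' B).hom) ▷ B' ⊗≫
        ((β_ A B).hom ▷ (A' ⊗ B') ≫ (B ⊗ A) ◁ (β_ A' B').hom) ⊗≫
        B ◁ (β_ A B').hom ▷ A' ⊗≫ 𝟙 _ := by monoidal
    _ = _ := by
      rw [SymmetricCategory.symmetry, ← MonoidalCategory.tensorHom_def]
      monoidal

/-- Here and in the next three lemmas `f`, `g`, `h` stand for the isomorphisms `FTree.tensorIso` of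
the subwords, so that each lemma is one case of `FHom.tensorIso_naturality`. -/
theorem tensorμ_associator_comp {A A' B B' D D' E F G : C} (f : A ⊗ A' ⟶ E) (g : B ⊗ B' ⟶ F)
    (h : D ⊗ D' ⟶ G) :
    ((α_ A B D).hom ⊗ₘ (α_ A' B' D').hom) ≫ tensorμ A (B ⊗ D) A' (B' ⊗ D') ≫
        (f ⊗ₘ (tensorμ B D B' D' ≫ (g ⊗ₘ h))) =
      (tensorμ (A ⊗ B) D (A' ⊗ B') D' ≫ ((tensorμ A B A' B' ≫ (f ⊗ₘ g)) ⊗ₘ h)) ≫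
        (α_ E F G).hom := by
  have h₁ : (f ⊗ₘ (tensorμ B D B' D' ≫ (g ⊗ₘ h))) =
      (A ⊗ A') ◁ tensorμ B D B' D' ≫ (f ⊗ₘ (g ⊗ₘ h)) := by
    rw [← id_tensorHom, tensorHom_comp_tensorHom, Category.id_comp]
  have h₂ : ((tensorμ A B A' B' ≫ (f ⊗ₘ g)) ⊗ₘ h) =
      tensorμ A B A' B' ▷ (D ⊗ D') ≫ ((f ⊗ₘ g) ⊗ₘ h) := by
    rw [← tensorHom_id, tensorHom_comp_tensorHom, Category.id_comp]
  rw [h₁, h₂, ← associator_monoidal_assoc]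
  simp only [Category.assoc, associator_naturality]

theorem tensorμ_leftUnitor_comp {A A' E : C} (f : A ⊗ A' ⟶ E) :
    ((λ_ A).hom ⊗ₘ (λ_ A').hom) ≫ f =
      (tensorμ (𝟙_ C) A (𝟙_ C) A' ≫ ((λ_ (𝟙_ C)).hom ⊗ₘ f)) ≫ (λ_ E).hom := by
  rw [leftUnitor_monoidal, MonoidalCategory.tensorHom_def]
  simp only [Category.assoc, leftUnitor_naturality]

theorem tensorμ_rightUnitor_comp {A A' E : C} (f : A ⊗ A' ⟶ E) :
    ((ρ_ A).hom ⊗ₘ (ρ_ A').hom) ≫ f =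
      (tensorμ A (𝟙_ C) A' (𝟙_ C) ≫ (f ⊗ₘ (λ_ (𝟙_ C)).hom)) ≫ (ρ_ E).hom := by
  rw [rightUnitor_monoidal, MonoidalCategory.tensorHom_def']
  simp only [Category.assoc, rightUnitor_naturality]

theorem tensorμ_braiding_comp {A A' B B' E F : C} (f : A ⊗ A' ⟶ E) (g : B ⊗ B' ⟶ F) :
    ((β_ A B).hom ⊗ₘ (β_ A' B').hom) ≫ tensorμ B A B' A' ≫ (g ⊗ₘ f) =
      (tensorμ A B A' B' ≫ (f ⊗ₘ g)) ≫ (β_ E F).hom := by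
  rw [Category.assoc, braiding_naturality, reassoc_of% braiding_tensorμ]

/-- The `tensor` case: naturality of `tensorμ` joins the squares of the two factors. -/
theorem tensorμ_comp_eq {A A' B B' D D' E E' P P' Q Q' : C} {a : A ⟶ A'} {b : B ⟶ B'} {c : D ⟶ D'}
    {d : E ⟶ E'} {m : A' ⊗ D' ⟶ P'} {m' : A ⊗ D ⟶ P} {p : P ⟶ P'} {n : B' ⊗ E' ⟶ Q'}
    {n' : B ⊗ E ⟶ Q} {q : Q ⟶ Q'} (h : (a ⊗ₘ c) ≫ m = m' ≫ p) (h' : (b ⊗ₘ d) ≫ n = n' ≫ q) :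
    ((a ⊗ₘ b) ⊗ₘ (c ⊗ₘ d)) ≫ tensorμ A' B' D' E' ≫ (m ⊗ₘ n) =
      (tensorμ A B D E ≫ (m' ⊗ₘ n')) ≫ (p ⊗ₘ q) := by
  rw [tensorμ_natural_assoc, tensorHom_comp_tensorHom, h, h', ← tensorHom_comp_tensorHom,
    Category.assoc]

/-- A word commutes with the tensor product of families. -/
def FTree.tensorIso : (T : FTree ι) → (y z : ι → C) →
    (T.eval y ⊗ T.eval z ≅ T.eval fun i => y i ⊗ z i)
  | .unit, _, _ => λ_ (𝟙_ C)
  | .var _, _, _ => Iso.refl _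
  | .node T U, y, z =>
    ⟨tensorμ _ _ _ _, tensorδ _ _ _ _, tensorμ_tensorδ _ _ _ _, tensorδ_tensorμ _ _ _ _⟩ ≪≫
      (T.tensorIso y z ⊗ᵢ U.tensorIso y z)

/-- This expresses that `⊗`, as a functor of two variables, is symmetric monoidal, with structure
isomorphisms `tensorμ` and `λ_ (𝟙_ C)`: the generating isomorphisms are respected, hence so are all
formal composites. -/
theorem FHom.tensorIso_naturality {T T' : FTree ι} (f : FHom T T') (y z : ι → C) :
    ((f.eval y).hom ⊗ₘ (f.eval z).hom) ≫ (T'.tensorIso y z).hom =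
      (T.tensorIso y z).hom ≫ (f.eval fun i => y i ⊗ z i).hom := by
  induction f with
  | refl T => simp [FHom.eval]
  | symm f ih => exact tensor_inv_comp_eq (f.eval y) (f.eval z) _ _ _ ih
  | trans f g ih ih' =>
    simp only [FHom.eval, Iso.trans_hom]
    rw [← tensorHom_comp_tensorHom, Category.assoc, ih', reassoc_of% ih]
  | @tensor T T' U U' f g ih ih' =>
    exact tensorμ_comp_eq ih ih'
  | assoc T U V => exact tensorμ_associator_comp _ _ _
  | lUnit T => exact tensorμ_leftUnitor_comp _
  | rUnit T => exact tensorμ_rightUnitor_comp _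
  | braid T U => exact tensorμ_braiding_comp _ _

/-- The value of a formal isomorphism at `x` is determined by its values at `y` and `z` if
`x = y ⊗ z`. -/
theorem FHom.eval_eq_of_tensor {T T' : FTree ι} (f g : FHom T T') {x y z : ι → C}
    (e : ∀ i, x i ≅ y i ⊗ z i) (hy : f.eval y = g.eval y) (hz : f.eval z = g.eval z) :
    f.eval x = g.eval x := by
  have h : (f.eval fun i => y i ⊗ z i).hom = (g.eval fun i => y i ⊗ z i).hom := by
    have hf := f.tensorIso_naturality y z
    have hg := g.tensorIso_naturality y z
    rw [hy, hz, hg] at hf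
    exact ((cancel_epi _).1 hf).symm
  -- Naturality transports the equality from the family `y ⊗ z` to the isomorphic family `x`.
  have hf := f.eval_naturality fun i => (e i).inv
  have hg := g.eval_naturality fun i => (e i).inv
  rw [h, hg] at hf
  have : IsIso (T.evalMap fun i => (e i).inv) :=
    ⟨T.evalMap fun i => (e i).hom, by simp [← FTree.evalMap_comp, FTree.evalMap_id],
      by simp [← FTree.evalMap_comp, FTree.evalMap_id]⟩
  exact Iso.ext ((cancel_epi _).1 hf).symm

end Eval

section Eval

variable {ι : Type} {C : Type u} [Category.{v} C] [MonoidalCategory C]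

/-! ### Words with at most one variable different from the unit -/

/-- Either the unit or the object `X`. -/
def unitOr (X : C) : Bool → C
  | false => 𝟙_ C
  | true => X

/-- The canonical morphisms to the unit and to `X` from words all of whose variables, with at most
one exception, are identified with the unit, and the exceptional one with `X`. -/
inductive Reduces (w : ι → Prop) (X : C) {x : ι → C} (e : ∀ i, ¬ w i → (x i ≅ 𝟙_ C))
    (e' : ∀ i, w i → (x i ≅ X)) : (T : FTree ι) → (b : Bool) → (T.eval x ⟶ unitOr X b) → Prop
  | unit : Reduces w X e e' .unit false (𝟙 (𝟙_ C))
  | varUnit (i) (h : ¬ w i) : Reduces w X e e' (.var i) false (e i h).hom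
  | var (i) (h : w i) : Reduces w X e e' (.var i) true (e' i h).hom
  | node {T U f g} : Reduces w X e e' T false f → Reduces w X e e' U false g →
      Reduces w X e e' (.node T U) false ((f ⊗ₘ g) ≫ (λ_ (𝟙_ C)).hom)
  | nodeLeft {T U f g} : Reduces w X e e' T true f → Reduces w X e e' U false g →
      Reduces w X e e' (.node T U) true ((f ⊗ₘ g) ≫ (ρ_ X).hom)
  | nodeRight {T U f g} : Reduces w X e e' T false f → Reduces w X e e' U true g →
      Reduces w X e e' (.node T U) true ((f ⊗ₘ g) ≫ (λ_ X).hom)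

/-- This and the next two lemmas are the associator cases of `Reduces.hom_comp`, sorted by the
position of the factor that may differ from the unit: third, first, second. If there is none, `Z` is
the unit. -/
theorem associator_comp_leftUnitor {A B D Z : C} (f : A ⟶ 𝟙_ C) (g : B ⟶ 𝟙_ C) (h : D ⟶ Z) :
    (α_ A B D).hom ≫ (f ⊗ₘ ((g ⊗ₘ h) ≫ (λ_ Z).hom)) ≫ (λ_ Z).hom =
      (((f ⊗ₘ g) ≫ (λ_ (𝟙_ C)).hom) ⊗ₘ h) ≫ (λ_ Z).hom := by
  monoidal

theorem associator_comp_rightUnitor {A B D Z : C} (f : A ⟶ Z) (g : B ⟶ 𝟙_ C) (h : D ⟶ 𝟙_ C) :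
    (α_ A B D).hom ≫ (f ⊗ₘ ((g ⊗ₘ h) ≫ (λ_ (𝟙_ C)).hom)) ≫ (ρ_ Z).hom =
      (((f ⊗ₘ g) ≫ (ρ_ Z).hom) ⊗ₘ h) ≫ (ρ_ Z).hom := by
  monoidal

theorem associator_comp_unitors {A B D Z : C} (f : A ⟶ 𝟙_ C) (g : B ⟶ Z) (h : D ⟶ 𝟙_ C) :
    (α_ A B D).hom ≫ (f ⊗ₘ ((g ⊗ₘ h) ≫ (ρ_ Z).hom)) ≫ (λ_ Z).hom =
      (((f ⊗ₘ g) ≫ (λ_ Z).hom) ⊗ₘ h) ≫ (ρ_ Z).hom := by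
  monoidal

theorem isIso_tensorHom_comp {A B D E F : C} (f : A ⟶ D) (g : B ⟶ E) (hf : IsIso f) (hg : IsIso g)
    (e : D ⊗ E ≅ F) : IsIso ((f ⊗ₘ g) ≫ e.hom) :=
  inferInstance

section Reduces

variable {w : ι → Prop} {X : C} {x : ι → C} {e : ∀ i, ¬ w i → (x i ≅ 𝟙_ C)}
  {e' : ∀ i, w i → (x i ≅ X)}

theorem Reduces.isIso {T : FTree ι} {b : Bool} {f : T.eval x ⟶ unitOr X b}
    (h : Reduces w X e e' T b f) : IsIso f := by
  induction h with
  | unit => exact inferInstanceAs (IsIso (𝟙 _))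
  | varUnit i h => exact inferInstanceAs (IsIso (e i h).hom)
  | var i h => exact inferInstanceAs (IsIso (e' i h).hom)
  | node _ _ ihf ihg => exact isIso_tensorHom_comp _ _ ihf ihg _
  | nodeLeft _ _ ihf ihg => exact isIso_tensorHom_comp _ _ ihf ihg _
  | nodeRight _ _ ihf ihg => exact isIso_tensorHom_comp _ _ ihf ihg _

/-- The flag records whether the exceptional variable occurs. That it is determined excludes
comparing `nodeLeft` with `nodeRight` in `Reduces.unique`. -/
theorem Reduces.bool_unique {T : FTree ι} {b b' : Bool} {f : T.eval x ⟶ unitOr X b}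
    {f' : T.eval x ⟶ unitOr X b'} (h : Reduces w X e e' T b f) (h' : Reduces w X e e' T b' f') :
    b = b' := by
  induction h generalizing b' with
  | unit => cases h'; rfl
  | varUnit i h => cases h' <;> first | rfl | contradiction
  | var i h => cases h' <;> first | rfl | contradiction
  | node _ _ ihf ihg =>
    cases h' with
    | node hf hg => rfl
    | nodeLeft hf hg => exact ihf hf
    | nodeRight hf hg => exact ihg hg
  | nodeLeft _ _ ihf ihg =>
    cases h' with
    | node hf hg => exact ihf hf
    | nodeLeft hf hg => rfl
    | nodeRight hf hg => rfl
  | nodeRight _ _ ihf ihg =>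
    cases h' with
    | node hf hg => exact ihg hg
    | nodeLeft hf hg => rfl
    | nodeRight hf hg => rfl

theorem Reduces.unique {T : FTree ι} {b : Bool} {f f' : T.eval x ⟶ unitOr X b}
    (h : Reduces w X e e' T b f) (h' : Reduces w X e e' T b f') : f = f' := by
  induction h with
  | unit => cases h'; rfl
  | varUnit i h => cases h'; rfl
  | var i h => cases h'; rfl
  | node _ _ ihf ihg =>
    cases h' with
    | node hf hg => rw [ihf hf, ihg hg]
  | nodeLeft hf₀ _ ihf ihg =>
    cases h' with
    | nodeLeft hf hg => rw [ihf hf, ihg hg]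
    | nodeRight hf hg => cases hf₀.bool_unique hf
  | nodeRight hf₀ _ ihf ihg =>
    cases h' with
    | nodeLeft hf hg => cases hf₀.bool_unique hf
    | nodeRight hf hg => rw [ihf hf, ihg hg]

theorem Reduces.exists_false (T : FTree ι) (h : ∀ i ∈ T.leaves, ¬ w i) :
    ∃ f, Reduces w X e e' T false f := by
  induction T with
  | unit => exact ⟨_, .unit⟩
  | var i => exact ⟨_, .varUnit i (h i (by simp [FTree.leaves]))⟩
  | node T U ihT ihU =>
    obtain ⟨f, hf⟩ := ihT fun i hi => h i (List.mem_append_left _ hi)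
    obtain ⟨g, hg⟩ := ihU fun i hi => h i (List.mem_append_right _ hi)
    exact ⟨_, .node hf hg⟩

/-- At a node at most one of the two subwords contains the exceptional variable, since that variable
is unique and not repeated. The other subword reduces to the unit. -/
theorem Reduces.exists_of_nodup (T : FTree ι) (hT : T.leaves.Nodup)
    (hw : ∀ i j, w i → w j → i = j) : ∃ b f, Reduces w X e e' T b f := by
  induction T with
  | unit => exact ⟨_, _, .unit⟩
  | var i =>
    by_cases h : w i
    · exact ⟨_, _, .var i h⟩
    · exact ⟨_, _, .varUnit i h⟩
  | node T U ihT ihU =>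
    have hd := List.nodup_append.1 hT
    by_cases h : ∃ i ∈ T.leaves, w i
    · obtain ⟨i, hi, hwi⟩ := h
      obtain ⟨b, f, hf⟩ := ihT hd.1
      obtain ⟨g, hg⟩ := Reduces.exists_false (e := e) (e' := e') U fun j hj hwj =>
        hd.2.2 i hi j hj (hw i j hwi hwj)
      cases b
      · exact ⟨_, _, .node hf hg⟩
      · exact ⟨_, _, .nodeLeft hf hg⟩
    · obtain ⟨f, hf⟩ := Reduces.exists_false (e := e) (e' := e') T fun j hj hwj => h ⟨j, hj, hwj⟩
      obtain ⟨b, g, hg⟩ := ihU hd.2.1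
      cases b
      · exact ⟨_, _, .node hf hg⟩
      · exact ⟨_, _, .nodeRight hf hg⟩

theorem Reduces.of_eq {T : FTree ι} {b : Bool} {f f' : T.eval x ⟶ unitOr X b}
    (h : Reduces w X e e' T b f) (hf : f = f') : Reduces w X e e' T b f' := hf ▸ h

variable [SymmetricCategory C]

theorem braiding_comp_leftUnitor {A B Z : C} (f : A ⟶ Z) (g : B ⟶ 𝟙_ C) :
    (β_ A B).hom ≫ (g ⊗ₘ f) ≫ (λ_ Z).hom = (f ⊗ₘ g) ≫ (ρ_ Z).hom := by
  rw [← braiding_naturality_assoc, braiding_leftUnitor]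

theorem braiding_comp_rightUnitor {A B Z : C} (f : A ⟶ 𝟙_ C) (g : B ⟶ Z) :
    (β_ A B).hom ≫ (g ⊗ₘ f) ≫ (ρ_ Z).hom = (f ⊗ₘ g) ≫ (λ_ Z).hom := by
  rw [← braiding_naturality_assoc, braiding_rightUnitor]

theorem braiding_comp_unitor {A B : C} (f : A ⟶ 𝟙_ C) (g : B ⟶ 𝟙_ C) :
    (β_ A B).hom ≫ (g ⊗ₘ f) ≫ (λ_ (𝟙_ C)).hom = (f ⊗ₘ g) ≫ (λ_ (𝟙_ C)).hom := by
  rw [braiding_comp_leftUnitor, unitors_equal]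

/-- Both directions are proved together so that the case of a formal inverse merely exchanges them.
The remaining cases are the triangle-type identities above. -/
theorem Reduces.hom_comp {T T' : FTree ι} (φ : FHom T T') :
    (∀ b f, Reduces w X e e' T b f → Reduces w X e e' T' b ((φ.eval x).inv ≫ f)) ∧
      ∀ b f, Reduces w X e e' T' b f → Reduces w X e e' T b ((φ.eval x).hom ≫ f) := by
  induction φ with
  | refl T => simp [FHom.eval]
  | symm f ih => exact ⟨ih.2, ih.1⟩
  | trans f g ih ih' =>
    refine ⟨fun b k hk => (ih'.1 _ _ (ih.1 _ _ hk)).of_eq ?_,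
      fun b k hk => (ih.2 _ _ (ih'.2 _ _ hk)).of_eq ?_⟩ <;> simp [FHom.eval]
  | tensor f g ih ih' =>
    constructor
    · intro b k hk
      cases hk with
      | node h h' =>
        exact (Reduces.node (ih.1 _ _ h) (ih'.1 _ _ h')).of_eq
          (tensorHom_comp_tensorHom_assoc _ _ _ _ _).symm
      | nodeLeft h h' =>
        exact (Reduces.nodeLeft (ih.1 _ _ h) (ih'.1 _ _ h')).of_eq
          (tensorHom_comp_tensorHom_assoc _ _ _ _ _).symm
      | nodeRight h h' =>
        exact (Reduces.nodeRight (ih.1 _ _ h) (ih'.1 _ _ h')).of_eq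
          (tensorHom_comp_tensorHom_assoc _ _ _ _ _).symm
    · intro b k hk
      cases hk with
      | node h h' =>
        exact (Reduces.node (ih.2 _ _ h) (ih'.2 _ _ h')).of_eq
          (tensorHom_comp_tensorHom_assoc _ _ _ _ _).symm
      | nodeLeft h h' =>
        exact (Reduces.nodeLeft (ih.2 _ _ h) (ih'.2 _ _ h')).of_eq
          (tensorHom_comp_tensorHom_assoc _ _ _ _ _).symm
      | nodeRight h h' =>
        exact (Reduces.nodeRight (ih.2 _ _ h) (ih'.2 _ _ h')).of_eq
          (tensorHom_comp_tensorHom_assoc _ _ _ _ _).symm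
  | assoc T U V =>
    constructor
    · intro b k hk
      cases hk with
      | node h h' =>
        cases h with
        | node h h'' =>
          exact (Reduces.node h (.node h'' h')).of_eq
            ((Iso.eq_inv_comp _).2 (associator_comp_leftUnitor _ _ _))
      | nodeLeft h h' =>
        cases h with
        | nodeLeft h h'' =>
          exact (Reduces.nodeLeft h (.node h'' h')).of_eq
            ((Iso.eq_inv_comp _).2 (associator_comp_rightUnitor _ _ _))
        | nodeRight h h'' =>
          exact (Reduces.nodeRight h (.nodeLeft h'' h')).of_eq
            ((Iso.eq_inv_comp _).2 (associator_comp_unitors _ _ _))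
      | nodeRight h h' =>
        cases h with
        | node h h'' =>
          exact (Reduces.nodeRight h (.nodeRight h'' h')).of_eq
            ((Iso.eq_inv_comp _).2 (associator_comp_leftUnitor _ _ _))
    · intro b k hk
      cases hk with
      | node h h' =>
        cases h' with
        | node h' h'' =>
          exact (Reduces.node (.node h h') h'').of_eq (associator_comp_leftUnitor _ _ _).symm
      | nodeLeft h h' =>
        cases h' with
        | node h' h'' =>
          exact (Reduces.nodeLeft (.nodeLeft h h') h'').of_eq
            (associator_comp_rightUnitor _ _ _).symm
      | nodeRight h h' =>
        cases h' with
        | nodeLeft h' h'' =>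
          exact (Reduces.nodeLeft (.nodeRight h h') h'').of_eq (associator_comp_unitors _ _ _).symm
        | nodeRight h' h'' =>
          exact (Reduces.nodeRight (.node h h') h'').of_eq (associator_comp_leftUnitor _ _ _).symm
  | lUnit T =>
    have key {Z : C} (f : T.eval x ⟶ Z) :
        (𝟙 (𝟙_ C) ⊗ₘ f) ≫ (λ_ Z).hom = (λ_ (T.eval x)).hom ≫ f := by simp
    constructor
    · intro b k hk
      cases hk with
      -- The only canonical morphism from the word `unit` is the identity, with flag `false`.
      | node h h' => cases h; exact h'.of_eq ((Iso.eq_inv_comp _).2 (key _).symm)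
      | nodeLeft h h' => cases h
      | nodeRight h h' => cases h; exact h'.of_eq ((Iso.eq_inv_comp _).2 (key _).symm)
    · rintro (_ | _) k hk
      · exact (Reduces.node .unit hk).of_eq (key _)
      · exact (Reduces.nodeRight .unit hk).of_eq (key _)
  | rUnit T =>
    have key {Z : C} (f : T.eval x ⟶ Z) :
        (f ⊗ₘ 𝟙 (𝟙_ C)) ≫ (ρ_ Z).hom = (ρ_ (T.eval x)).hom ≫ f := by simp
    have key' (f : T.eval x ⟶ 𝟙_ C) :
        (f ⊗ₘ 𝟙 (𝟙_ C)) ≫ (λ_ (𝟙_ C)).hom = (ρ_ (T.eval x)).hom ≫ f := by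
      rw [unitors_equal, key]
    constructor
    · intro b k hk
      cases hk with
      | node h h' => cases h'; exact h.of_eq ((Iso.eq_inv_comp _).2 (key' _).symm)
      | nodeLeft h h' => cases h'; exact h.of_eq ((Iso.eq_inv_comp _).2 (key _).symm)
      | nodeRight h h' => cases h'
    · rintro (_ | _) k hk
      · exact (Reduces.node hk .unit).of_eq (key' _)
      · exact (Reduces.nodeLeft hk .unit).of_eq (key _)
  | braid T U =>
    constructor
    · intro b k hk
      cases hk with
      | node h h' =>
        exact (Reduces.node h' h).of_eq ((Iso.eq_inv_comp _).2 (braiding_comp_unitor _ _))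
      | nodeLeft h h' =>
        exact (Reduces.nodeRight h' h).of_eq ((Iso.eq_inv_comp _).2 (braiding_comp_leftUnitor _ _))
      | nodeRight h h' =>
        exact (Reduces.nodeLeft h' h).of_eq ((Iso.eq_inv_comp _).2 (braiding_comp_rightUnitor _ _))
    · intro b k hk
      cases hk with
      | node h h' => exact (Reduces.node h' h).of_eq (braiding_comp_unitor _ _).symm
      | nodeLeft h h' => exact (Reduces.nodeRight h' h).of_eq (braiding_comp_rightUnitor _ _).symm
      | nodeRight h h' => exact (Reduces.nodeLeft h' h).of_eq (braiding_comp_leftUnitor _ _).symm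

/-- Composing `f` with the inverse of either value gives the canonical morphism of `T'`. This
morphism is unique, and `f` can be cancelled because it is an isomorphism. -/
theorem FHom.eval_eq_of_reduces {T T' : FTree ι} (φ ψ : FHom T T') {b : Bool}
    {f : T.eval x ⟶ unitOr X b} (h : Reduces w X e e' T b f) : φ.eval x = ψ.eval x := by
  have := ((Reduces.hom_comp φ).1 b f h).unique ((Reduces.hom_comp ψ).1 b f h)
  have hf := h.isIso
  exact Iso.ext_inv ((cancel_mono _).1 this)

end Reduces

/-! ### The coherence theorem -/

variable [SymmetricCategory C]

/-- Coherence: two formal isomorphisms between words without repeated variables have the same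
value. -/
theorem FHom.eval_eq [Finite ι] {T T' : FTree ι} (hT : T.leaves.Nodup) (f g : FHom T T')
    (x : ι → C) : f.eval x = g.eval x := by
  classical
  -- Induction on the set of variables that keep their value, all others being replaced by the unit.
  have key : ∀ S : Finset ι, (f.eval fun i => if i ∈ S then x i else 𝟙_ C) =
      g.eval fun i => if i ∈ S then x i else 𝟙_ C := by
    intro S
    induction S using Finset.induction_on with
    | empty =>
      obtain ⟨k, hk⟩ := Reduces.exists_false (w := fun _ => False) (X := 𝟙_ C)
        (x := fun i => if i ∈ (∅ : Finset ι) then x i else 𝟙_ C)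
        (e := fun i _ => eqToIso (by simp)) (e' := fun i h => h.elim) T (by simp)
      exact f.eval_eq_of_reduces g hk
    | insert a S ha ih =>
      -- The family for `insert a S` is the tensor product of the family concentrated at `a` and the
      -- family for `S`, up to unitors. At `a` the second factor is the unit because `a ∉ S`;
      -- elsewhere the first factor is.
      refine f.eval_eq_of_tensor g (y := fun i => if i = a then x a else 𝟙_ C) (fun i => ?_) ?_ ih
      · by_cases h : i = a
        · subst h
          exact eqToIso (by simp) ≪≫ (ρ_ (x i)).symm ≪≫ eqToIso (by simp [ha])
        · exact (λ_ _).symm ≪≫ eqToIso (by simp [h])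
      -- Only here is it used that no variable is repeated.
      · obtain ⟨b, k, hk⟩ := Reduces.exists_of_nodup (w := fun i => i = a) (X := x a)
          (x := fun i => if i = a then x a else 𝟙_ C)
          (e := fun i h => eqToIso (by simp [h])) (e' := fun i h => eqToIso (by simp [h])) T hT
          (fun i j hi hj => hi.trans hj.symm)
        exact f.eval_eq_of_reduces g hk
  cases nonempty_fintype ι
  have hx : (fun i => if i ∈ Finset.univ then x i else 𝟙_ C) = x := by simp
  have := key Finset.univ
  rwa [hx] at this

end Eval

/-! ### Substitution of formal isomorphisms -/

section Arrow

variable {C : Type u} [Category.{v} C]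

/-- Values of a substituted word agree with iterated values only up to a propositional equality of
objects. Stating identities in `Arrow C` avoids transports, and this lemma compares composites
factor by factor. -/
theorem arrow_comp_congr {X Y Z X' Y' Z' : C} {f : X ⟶ Y} {g : Y ⟶ Z} {f' : X' ⟶ Y'}
    {g' : Y' ⟶ Z'} (hf : Arrow.mk f = Arrow.mk f') (hg : Arrow.mk g = Arrow.mk g') :
    Arrow.mk (f ≫ g) = Arrow.mk (f' ≫ g') := by
  obtain rfl : X = X' := congrArg Arrow.left hf
  obtain rfl : Y = Y' := congrArg Arrow.right hf
  obtain rfl : Z = Z' := congrArg Arrow.right hg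
  rw [Arrow.mk_inj] at hf hg
  rw [hf, hg]

theorem arrow_inv_congr {X Y X' Y' : C} {e : X ≅ Y} {e' : X' ≅ Y'}
    (h : Arrow.mk e.hom = Arrow.mk e'.hom) : Arrow.mk e.inv = Arrow.mk e'.inv := by
  obtain rfl : X = X' := congrArg Arrow.left h
  obtain rfl : Y = Y' := congrArg Arrow.right h
  rw [Arrow.mk_inj] at h
  rw [Iso.ext h]

theorem arrow_id_congr {X Y : C} (h : X = Y) : Arrow.mk (𝟙 X) = Arrow.mk (𝟙 Y) := by rw [h]

end Arrow

section Bind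

variable {ι κ : Type}

/-- Renaming of the variables of a word. -/
def FTree.map (s : ι → κ) (T : FTree ι) : FTree κ := T.bind fun i => .var (s i)

theorem FTree.bind_bind {μ : Type} (T : FTree ι) (s : ι → FTree κ) (r : κ → FTree μ) :
    (T.bind s).bind r = T.bind fun i => (s i).bind r := by
  induction T with
  | unit => rfl
  | var i => rfl
  | node T U ihT ihU => simp only [FTree.bind, ihT, ihU]

theorem FTree.bind_var (T : FTree ι) : T.bind .var = T := by
  induction T with
  | unit => rfl
  | var i => rfl
  | node T U ihT ihU => simp only [FTree.bind, ihT, ihU]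

/-- Substitution of words into a formal isomorphism. -/
def FHom.bind : {T T' : FTree ι} → FHom T T' → (s : ι → FTree κ) → FHom (T.bind s) (T'.bind s)
  | _, _, .refl _, _ => .refl _
  | _, _, .symm f, s => .symm (f.bind s)
  | _, _, .trans f g, s => .trans (f.bind s) (g.bind s)
  | _, _, .tensor f g, s => .tensor (f.bind s) (g.bind s)
  | _, _, .assoc _ _ _, _ => .assoc _ _ _
  | _, _, .lUnit _, _ => .lUnit _
  | _, _, .rUnit _, _ => .rUnit _
  | _, _, .braid _ _, _ => .braid _ _

/-- Substitution of formal isomorphisms into a word. -/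
def FTree.bindHom : (T : FTree ι) → {s s' : ι → FTree κ} → (∀ i, FHom (s i) (s' i)) →
    FHom (T.bind s) (T.bind s')
  | .unit, _, _, _ => .refl _
  | .var i, _, _, f => f i
  | .node T U, _, _, f => .tensor (T.bindHom f) (U.bindHom f)

variable {C : Type u} [Category.{v} C] [MonoidalCategory C]

/-- The tensor product of arrows. -/
def tensorArrow (a b : Arrow C) : Arrow C := Arrow.mk (a.hom ⊗ₘ b.hom)

/-- The value of a word at a family of arrows. -/
def FTree.evalArrow (T : FTree ι) (a : ι → Arrow C) : Arrow C :=
  Arrow.mk (T.evalMap fun i => (a i).hom)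

theorem FTree.arrow_evalMap_congr (T : FTree ι) {x y x' y' : ι → C} {h : ∀ i, x i ⟶ y i}
    {h' : ∀ i, x' i ⟶ y' i} (H : ∀ i, Arrow.mk (h i) = Arrow.mk (h' i)) :
    Arrow.mk (T.evalMap h) = Arrow.mk (T.evalMap h') :=
  congrArg T.evalArrow (funext H)

theorem FTree.eval_bind (T : FTree ι) (s : ι → FTree κ) (x : κ → C) :
    (T.bind s).eval x = T.eval fun i => (s i).eval x := by
  induction T with
  | unit => rfl
  | var i => rfl
  | node T U ihT ihU => exact congrArg₂ (· ⊗ ·) ihT ihU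

theorem FTree.evalArrow_bind (T : FTree ι) (s : ι → FTree κ) (a : κ → Arrow C) :
    (T.bind s).evalArrow a = T.evalArrow fun i => (s i).evalArrow a := by
  induction T with
  | unit => rfl
  | var i => rfl
  | node T U ihT ihU => exact congrArg₂ tensorArrow ihT ihU

theorem arrow_associator_congr {X Y Z X' Y' Z' : C} (hX : X = X') (hY : Y = Y') (hZ : Z = Z') :
    Arrow.mk (α_ X Y Z).hom = Arrow.mk (α_ X' Y' Z').hom := by
  rw [hX, hY, hZ]

variable [SymmetricCategory C]

theorem arrow_braiding_congr {X Y X' Y' : C} (hX : X = X') (hY : Y = Y') :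
    Arrow.mk (β_ X Y).hom = Arrow.mk (β_ X' Y').hom := by
  rw [hX, hY]

theorem FHom.arrow_eval_bind {T T' : FTree ι} (f : FHom T T') (s : ι → FTree κ) (x : κ → C) :
    Arrow.mk ((f.bind s).eval x).hom = Arrow.mk (f.eval fun i => (s i).eval x).hom := by
  induction f with
  | refl T => exact arrow_id_congr (T.eval_bind s x)
  | symm f ih => exact arrow_inv_congr ih
  | trans f g ih ih' => exact arrow_comp_congr ih ih'
  | tensor f g ih ih' => exact congrArg₂ tensorArrow ih ih'
  | assoc T U V =>
    exact arrow_associator_congr (T.eval_bind s x) (U.eval_bind s x) (V.eval_bind s x)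
  | lUnit T => exact congrArg (fun a => Arrow.mk (λ_ a).hom) (T.eval_bind s x)
  | rUnit T => exact congrArg (fun a => Arrow.mk (ρ_ a).hom) (T.eval_bind s x)
  | braid T U => exact arrow_braiding_congr (T.eval_bind s x) (U.eval_bind s x)

theorem FTree.arrow_eval_bindHom (T : FTree ι) {s s' : ι → FTree κ} (f : ∀ i, FHom (s i) (s' i))
    (x : κ → C) :
    Arrow.mk ((T.bindHom f).eval x).hom =
      Arrow.mk (T.evalMap fun i => ((f i).eval x).hom) := by
  induction T with
  | unit => rfl
  | var i => rfl
  | node T U ihT ihU => exact congrArg₂ tensorArrow ihT ihU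

/-- The form in which coherence is applied: a chosen formal isomorphism may be replaced by any other
that suits the computation, even if the words match only propositionally. -/
theorem FHom.arrow_eval_congr [Finite ι] {T T' U U' : FTree ι} (hT : T = U) (hT' : T' = U')
    (h : T.leaves.Nodup) (f : FHom T T') (g : FHom U U') {x y : ι → C} (k : ∀ i, x i ⟶ y i) :
    Arrow.mk ((f.eval x).hom ≫ T'.evalMap k) = Arrow.mk ((g.eval x).hom ≫ U'.evalMap k) := by
  subst hT hT'
  rw [FHom.eval_eq h f g]

end Bind

/-! ### The labelled word of an object of `Y(n)` -/

section Label

variable {ι κ : Type}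

/-- A tree with its variable slots labelled from left to right. -/
def ZTree.label : (t : ZTree) → (Fin t.arity → ι) → FTree ι
  | .unit, _ => .unit
  | .var, s => .var (s (0 : Fin 1))
  | .node t u, s => .node (t.label fun i => s (Fin.castAdd u.arity i))
      (u.label fun i => s (Fin.natAdd t.arity i))

theorem ZTree.label_congr {t t' : ZTree} (h : t = t') {s : Fin t.arity → ι} {s' : Fin t'.arity → ι}
    (hs : ∀ (i : Fin t.arity) (j : Fin t'.arity), (i : ℕ) = j → s i = s' j) :
    t.label s = t'.label s' := by
  subst h
  rw [funext fun i => hs i i rfl]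

theorem ZTree.label_bind (t : ZTree) (s : Fin t.arity → ι) (S : ι → FTree κ) (r : Fin t.arity → κ)
    (h : ∀ i, S (s i) = .var (r i)) : (t.label s).bind S = t.label r := by
  induction t with
  | unit => rfl
  | var => exact h (0 : Fin 1)
  | node t u iht ihu =>
    exact congrArg₂ FTree.node (iht _ _ fun i => h (Fin.castAdd _ i))
      (ihu _ _ fun i => h (Fin.natAdd _ i))

theorem ZTree.map_label (t : ZTree) (s : Fin t.arity → ι) (e : ι → κ) :
    (t.label s).map e = t.label fun i => e (s i) :=
  t.label_bind _ _ _ fun _ => rfl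

/-- Slot `j` of the tree put into slot `i` becomes slot `finSigmaFinEquiv ⟨i, j⟩`. The substitution
`S` is prescribed only at the labels `w i`, which leaves room for the permutation that labels the
outer tree in `yWord_comp`. -/
theorem ZTree.label_subst : ∀ (t : ZTree) (s : Fin t.arity → ZTree)
    (r : Fin (t.subst s).arity → κ) (w : Fin t.arity → ι) (S : ι → FTree κ)
    (_ : ∀ i, S (w i) = (s i).label fun j => r (Fin.cast (t.arity_subst s).symm
        (finSigmaFinEquiv (n := fun i => (s i).arity) ⟨i, j⟩))),
    (t.subst s).label r = (t.label w).bind S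
  | .unit, _, _, _, _, _ => rfl
  | .var, s, r, w, S, h => by
    refine Eq.trans ?_ (h (0 : Fin 1)).symm
    refine ZTree.label_congr rfl fun i j hij => congrArg r (Fin.ext ?_)
    exact hij.trans (finSigmaFinEquiv_one (n := fun i : Fin 1 => (s i).arity) ⟨0, j⟩).symm
  | .node t u, s, r, w, S, h => by
    refine congrArg₂ FTree.node (ZTree.label_subst t _ _ _ S fun i => ?_)
      (ZTree.label_subst u _ _ _ S fun i => ?_)
    · refine (h (Fin.castAdd u.arity i)).trans ?_
      refine ZTree.label_congr rfl fun a b hab => congrArg r (Fin.ext ?_)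
      obtain rfl := Fin.ext hab
      exact pos_castAdd (fun x : Fin (t.arity + u.arity) => (s x).arity) i a
    · refine (h (Fin.natAdd t.arity i)).trans ?_
      refine ZTree.label_congr rfl fun a b hab => congrArg r (Fin.ext ?_)
      obtain rfl := Fin.ext hab
      refine (pos_natAdd (fun x : Fin (t.arity + u.arity) => (s x).arity) i a).trans ?_
      exact congrArg (· + _) (ZTree.arity_subst t _).symm

theorem ZTree.leaves_label (t : ZTree) (s : Fin t.arity → ι) :
    (t.label s).leaves = List.ofFn s := by
  induction t with
  | unit => rfl
  | var => rfl
  | node t u iht ihu =>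
    refine (congrArg₂ (· ++ ·) (iht _) (ihu _)).trans ?_
    exact (List.ofFn_add (f := s)).symm

theorem ZTree.eq_of_label_eq {t t' : ZTree} {s : Fin t.arity → ι} {s' : Fin t'.arity → ι}
    (h : t.label s = t'.label s') : t = t' := by
  induction t generalizing t' with
  | unit => cases t' <;> first | rfl | cases h
  | var => cases t' <;> first | rfl | cases h
  | node t u iht ihu =>
    cases t' with
    | unit => cases h
    | var => cases h
    | node t' u' =>
      obtain ⟨h₁, h₂⟩ := FTree.node.inj h
      rw [iht h₁, ihu h₂]

theorem ZTree.label_injective {t : ZTree} {s s' : Fin t.arity → ι}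
    (h : t.label s = t.label s') : s = s' := by
  have := congrArg FTree.leaves h
  rwa [ZTree.leaves_label, ZTree.leaves_label, List.ofFn_inj] at this

end Label

section Word

/-- The tree of an object of `Y(n)`. -/
def yTree {n : ℕ} (p : Y.Obj n) : ZTree := (Codiscrete.as p).1.1

theorem arity_yTree {n : ℕ} (p : Y.Obj n) : (yTree p).arity = n := (Codiscrete.as p).1.2

/-- The permutation of an object of `Y(n)`. -/
def yPerm {n : ℕ} (p : Y.Obj n) : Equiv.Perm (Fin n) := (Codiscrete.as p).2

/-- The word of an object of `Y(n)`: as in an algebra over `Y`, the permutation `σ` puts the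
variable `σ⁻¹ i` into the slot `i`. -/
def yWord {n : ℕ} (p : Y.Obj n) : FTree (Fin n) :=
  (yTree p).label fun i => (yPerm p).symm (Fin.cast (arity_yTree p) i)

theorem yWord_perm {n : ℕ} (p : Y.Obj n) (σ : Equiv.Perm (Fin n)) :
    yWord ((Y.perm σ).obj p) = (yWord p).map σ.symm :=
  ((yTree p).map_label (fun i => (yPerm p).symm (Fin.cast (arity_yTree p) i)) σ.symm).symm

theorem castOp_val {m n : ℕ} (h : m = n) (z : Z.Op m) : (castOp h z).1 = z.1 := by
  subst h
  rfl

/-- The composition permutation of `L` is made for this: by `compPerm_symm_apply` its inverse sends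
slot `j` of block `i` to input `τ⁻¹ j` of operation `σ⁻¹ i`, with `τ` the permutation of that
operation, which is the label obtained by substitution. -/
theorem yWord_comp {n : ℕ} (p : Y.Obj n) {k : Fin n → ℕ} (q : ∀ i, Y.Obj (k i)) :
    yWord ((Y.comp k).obj (p, q)) =
      (yWord p).bind fun i => (yWord (q i)).map fun j => finSigmaFinEquiv ⟨i, j⟩ := by
  obtain ⟨⟨⟨t, rfl⟩, σ⟩⟩ := p
  refine (ZTree.label_congr (castOp_val _ _) (s' := fun z => (compPerm σ fun i => yPerm (q i)).symm
    (Fin.cast (sum_comp_symm σ k) (Fin.cast (Subtype.property (Z.comp ⟨t, rfl⟩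
      fun i => (Codiscrete.as (q (σ.symm i))).1)) z))) ?_).trans ?_
  · intro i j hij
    exact congrArg _ (Fin.ext hij)
  · refine ZTree.label_subst t _ _ _ _ fun i => ?_
    refine (ZTree.map_label _ _ _).trans (ZTree.label_congr rfl ?_)
    intro a b hab
    obtain rfl := Fin.ext hab
    refine (compPerm_symm_apply σ (fun i => yPerm (q i)) i
      (Fin.cast (arity_yTree _) a)).symm.trans ?_
    refine congrArg _ (Fin.ext ?_)
    exact pos_congr (fun i => (arity_yTree (q (σ.symm i))).symm) rfl rfl

theorem leaves_yWord {n : ℕ} (p : Y.Obj n) :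
    (yWord p).leaves = List.ofFn fun i => (yPerm p).symm (Fin.cast (arity_yTree p) i) :=
  ZTree.leaves_label _ _

/-- The labels are the values of a permutation, so coherence applies to every object of `Y`. -/
theorem nodup_leaves_yWord {n : ℕ} (p : Y.Obj n) : (yWord p).leaves.Nodup := by
  rw [leaves_yWord, List.nodup_ofFn]
  exact (yPerm p).symm.injective.comp (Fin.cast_injective _)

theorem mem_leaves_yWord {n : ℕ} (p : Y.Obj n) (i : Fin n) : i ∈ (yWord p).leaves := by
  rw [leaves_yWord, List.mem_ofFn]
  exact ⟨Fin.cast (arity_yTree p).symm (yPerm p i), by simp⟩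

theorem leaves_yWord_perm {n : ℕ} (p q : Y.Obj n) : (yWord p).leaves.Perm (yWord q).leaves :=
  (List.perm_ext_iff_of_nodup (nodup_leaves_yWord p) (nodup_leaves_yWord q)).2 fun i =>
    iff_of_true (mem_leaves_yWord p i) (mem_leaves_yWord q i)

/-- A formal isomorphism between the words of two objects of `Y(n)`. -/
noncomputable def yFHom {n : ℕ} (p q : Y.Obj n) : FHom (yWord p) (yWord q) :=
  (FHom.exists_of_perm (leaves_yWord_perm p q)).some

end Word

/-! ### The `Y`-algebra of a symmetric monoidal category -/

section Alg

variable (C : Type u) [Category.{v} C] [MonoidalCategory C] [SymmetricCategory C]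

/-- The action of `Y` on a symmetric monoidal category. -/
noncomputable def symmMonAlgebra : OperadAlgebra Y C where
  act n :=
    { obj := fun z => (yWord z.1).eval z.2
      map := fun {z z'} φ => ((yFHom z.1 z'.1).eval z.2).hom ≫ (yWord z'.1).evalMap φ.2
      map_id := fun z => by
        -- The formal isomorphisms `yFHom` are arbitrary choices; coherence makes them functorial,
        -- replacing the chosen one here by the identity and below by a composite.
        rw [FHom.eval_eq (nodup_leaves_yWord z.1) _ (.refl _)]
        exact (Category.id_comp _).trans (FTree.evalMap_id _ _)
      map_comp := fun {z z' z''} φ ψ => by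
        rw [FHom.eval_eq (nodup_leaves_yWord z.1) (yFHom z.1 z''.1)
          ((yFHom z.1 z'.1).trans (yFHom z'.1 z''.1))]
        have := (yFHom z'.1 z''.1).eval_naturality φ.2
        have h := (yWord z''.1).evalMap_comp φ.2 ψ.2
        simp only [FHom.eval, Iso.trans_hom, Category.assoc]
        refine congrArg (_ ≫ ·) ((congrArg (_ ≫ ·) h).trans ?_)
        rw [reassoc_of% this] }
  one_act {x y} h := by
    refine (FHom.arrow_eval_congr rfl rfl (nodup_leaves_yWord _) _ (.refl _) h).trans ?_
    exact congrArg Arrow.mk (Category.id_comp _)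
  comp_act {n p p'} f {k q q'} g {x y} h := by
    -- The chosen isomorphism of the composite operations is replaced by the one that first changes
    -- the outer word and then the words substituted into it.
    refine (FHom.arrow_eval_congr (yWord_comp p q) (yWord_comp p' q') (nodup_leaves_yWord _) _
      (((yFHom p p').bind _).trans ((yWord p').bindHom fun i =>
        (yFHom (q i) (q' i)).bind fun j => .var (finSigmaFinEquiv ⟨i, j⟩))) h).trans ?_
    refine (congrArg Arrow.mk (Category.assoc _ _ _)).trans (arrow_comp_congr ?_ ?_)
    · refine (FHom.arrow_eval_bind _ _ _).trans ?_
      exact congrArg (fun w => Arrow.mk ((yFHom p p').eval w).hom)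
        (funext fun i => FTree.eval_bind _ _ _)
    -- Functoriality of the outer word merges the inner isomorphisms with the morphisms `h` into the
    -- inner actions.
    · refine (arrow_comp_congr (FTree.arrow_eval_bindHom _ _ _)
        (FTree.evalArrow_bind _ _ fun i => Arrow.mk (h i))).trans ?_
      refine (congrArg Arrow.mk (FTree.evalMap_comp _ _ _).symm).trans ?_
      refine (yWord p').arrow_evalMap_congr fun i => ?_
      exact arrow_comp_congr (FHom.arrow_eval_bind _ _ _)
        (FTree.evalArrow_bind _ _ fun i => Arrow.mk (h i))
  perm_act {n p p'} f σ {x y} h := by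
    refine (FHom.arrow_eval_congr (yWord_perm p σ) (yWord_perm p' σ) (nodup_leaves_yWord _) _
      ((yFHom p p').bind _) h).trans ?_
    refine arrow_comp_congr (FHom.arrow_eval_bind _ _ _) ?_
    exact FTree.evalArrow_bind (yWord p') _ fun i => Arrow.mk (h i)

end Alg

/-! ### Actions of `Y` on arrows -/

section Words

variable {ι : Type}

theorem FTree.leaves_map {κ : Type} (T : FTree ι) (s : ι → κ) :
    (T.map s).leaves = T.leaves.map s := by
  induction T with
  | unit => rfl
  | var i => rfl
  | node T U ihT ihU =>
    exact (congrArg₂ (· ++ ·) ihT ihU).trans (List.map_append).symm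

/-- Every variable occurs in `yWord p`, so a renaming that creates no repetition separates all
variables. -/
theorem injective_of_nodup_leaves_map {n : ℕ} (p : Y.Obj n) {s : Fin n → ι}
    (h : ((yWord p).map s).leaves.Nodup) : Function.Injective s := by
  rw [FTree.leaves_map] at h
  exact fun i j hij =>
    List.inj_on_of_nodup_map h (mem_leaves_yWord p i) (mem_leaves_yWord p j) hij

theorem yWord_map_eq {n : ℕ} (p : Y.Obj n) (s : Fin n → ι) :
    (yWord p).map s =
      (yTree p).label fun i => s ((yPerm p).symm (Fin.cast (arity_yTree p) i)) :=
  ZTree.map_label _ _ _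

theorem arity_eq_of_map_eq {m n : ℕ} {p : Y.Obj m} {q : Y.Obj n} {s : Fin m → ι} {r : Fin n → ι}
    (h : (yWord p).map s = (yWord q).map r) : m = n := by
  rw [yWord_map_eq, yWord_map_eq] at h
  rw [← arity_yTree p, ← arity_yTree q, ZTree.eq_of_label_eq h]

/-- A labelled word determines its tree, so `p` and `q` differ only in their permutations `σ` and
`τ`, and `ρ = σ⁻¹ τ` relates both the operations and the labellings. -/
theorem exists_perm_of_map_eq {n : ℕ} {p q : Y.Obj n} {s r : Fin n → ι}
    (h : (yWord p).map s = (yWord q).map r) :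
    ∃ ρ : Equiv.Perm (Fin n), q = (Y.perm ρ).obj p ∧ r = s ∘ ρ := by
  rw [yWord_map_eq, yWord_map_eq] at h
  have ht := ZTree.eq_of_label_eq h
  obtain ⟨⟨⟨t, rfl⟩, σ⟩⟩ := p
  obtain ⟨⟨⟨t', ht'⟩, τ⟩⟩ := q
  obtain rfl : t = t' := ht
  have h := ZTree.label_injective h
  refine ⟨σ⁻¹ * τ, ?_, funext fun i => ?_⟩
  · change _ = Codiscrete.mk (_, σ * (σ⁻¹ * τ))
    rw [mul_inv_cancel_left]
    rfl
  · have := congrFun h (τ i)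
    change s (σ.symm (τ i)) = r (τ.symm (τ i)) at this
    rw [τ.symm_apply_apply] at this
    exact this.symm

end Words

section ActArrow

variable {ι : Type} {C : Type u} [Category.{v} C] (A : OperadAlgebra Y C)

/-- The action of the unique morphism `p ⟶ p'` of `Y(n)` on a family of arrows. -/
def OperadAlgebra.actArrow {n : ℕ} (p p' : Y.Obj n) (a : Fin n → Arrow C) : Arrow C :=
  Arrow.mk ((A.act n).map ((yHom p p', fun i => (a i).hom) :
    (p, fun i => (a i).left) ⟶ (p', fun i => (a i).right)))

theorem OperadAlgebra.mk_map_eq {n : ℕ} {p p' : Y.Obj n} (f : p ⟶ p') {x y : Fin n → C}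
    (h : ∀ i, x i ⟶ y i) :
    Arrow.mk ((A.act n).map ((f, h) : (p, x) ⟶ (p', y))) =
      A.actArrow p p' fun i => Arrow.mk (h i) :=
  rfl

theorem OperadAlgebra.actArrow_one (a : Fin 1 → Arrow C) : A.actArrow Y.one Y.one a = a 0 :=
  A.one_act fun i => (a i).hom

theorem OperadAlgebra.actArrow_comp {n : ℕ} (p p' : Y.Obj n) {k : Fin n → ℕ}
    (q q' : ∀ i, Y.Obj (k i)) (a : Fin (∑ i, k i) → Arrow C) :
    A.actArrow ((Y.comp k).obj (p, q)) ((Y.comp k).obj (p', q')) a =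
      A.actArrow p p' fun i => A.actArrow (q i) (q' i) fun j => a (finSigmaFinEquiv ⟨i, j⟩) :=
  A.comp_act (yHom p p') (fun i => yHom (q i) (q' i)) fun i => (a i).hom

theorem OperadAlgebra.actArrow_perm {n : ℕ} (p p' : Y.Obj n) (σ : Equiv.Perm (Fin n))
    (a : Fin n → Arrow C) :
    A.actArrow ((Y.perm σ).obj p) ((Y.perm σ).obj p') a =
      A.actArrow p p' fun i => a (σ.symm i) :=
  A.perm_act (yHom p p') σ fun i => (a i).hom

/-- The arrow `b` is the action, at the arrows `a`, of the unique isomorphism in `Y` between the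
operations described by the words `T` and `T'`. -/
def OperadAlgebra.Realizes (T T' : FTree ι) (a : ι → Arrow C) (b : Arrow C) : Prop :=
  T.leaves.Nodup ∧ ∃ (n : ℕ) (p p' : Y.Obj n) (s : Fin n → ι),
    T = (yWord p).map s ∧ T' = (yWord p').map s ∧ b = A.actArrow p p' fun i => a (s i)

variable {A}

namespace OperadAlgebra.Realizes

/-- Two presentations of the same pair of words differ by a permutation at each end. These
permutations coincide because the labels are distinct, and equivariance then identifies the two
actions. -/
theorem unique {T T' : FTree ι} {a : ι → Arrow C} {b b' : Arrow C} (h : A.Realizes T T' a b)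
    (h' : A.Realizes T T' a b') : b = b' := by
  obtain ⟨hT, n, p, p', s, rfl, rfl, rfl⟩ := h
  obtain ⟨-, m, q, q', r, h₁, h₂, rfl⟩ := h'
  obtain rfl := arity_eq_of_map_eq h₁
  obtain ⟨ρ, rfl, rfl⟩ := exists_perm_of_map_eq h₁
  obtain ⟨ρ', rfl, h₃⟩ := exists_perm_of_map_eq h₂
  obtain rfl : ρ = ρ' :=
    Equiv.ext fun i => injective_of_nodup_leaves_map p hT (congrFun h₃ i)
  rw [A.actArrow_perm]
  simp

theorem comp {T T' T'' : FTree ι} {x y z : ι → C} {f : ∀ i, x i ⟶ y i} {g : ∀ i, y i ⟶ z i}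
    {X Y Z : C} {φ : X ⟶ Y} {ψ : Y ⟶ Z} (h : A.Realizes T T' (fun i => Arrow.mk (f i)) (Arrow.mk φ))
    (h' : A.Realizes T' T'' (fun i => Arrow.mk (g i)) (Arrow.mk ψ)) :
    A.Realizes T T'' (fun i => Arrow.mk (f i ≫ g i)) (Arrow.mk (φ ≫ ψ)) := by
  obtain ⟨hT, n, p, p', s, rfl, rfl, hφ⟩ := h
  obtain ⟨-, m, q, q', r, h₁, rfl, hψ⟩ := h'
  obtain rfl := arity_eq_of_map_eq h₁
  obtain ⟨ρ, rfl, rfl⟩ := exists_perm_of_map_eq h₁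
  -- The second presentation is relabelled by `ρ`, so that it starts at the object `p'` where the
  -- first one ends. Functoriality of the action then applies.
  obtain ⟨q'', rfl⟩ : ∃ q'', q' = (ELZ.Y.perm ρ).obj q'' := by
    refine ⟨(ELZ.Y.perm ρ⁻¹).obj q', ?_⟩
    have h₂ := congrArg (fun F => F.obj q') (ELZ.Y.perm_mul ρ⁻¹ ρ)
    have h₃ := congrArg (fun F => F.obj q') (ELZ.Y.perm_one n)
    rw [inv_mul_cancel] at h₂
    exact h₃.symm.trans h₂
  refine ⟨hT, n, p, q'', s, rfl, ?_, ?_⟩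
  · rw [yWord_perm, FTree.map, FTree.map, FTree.bind_bind]
    refine congrArg (FTree.bind _) (funext fun i => ?_)
    simp [FTree.bind]
  · rw [A.actArrow_perm] at hψ
    have hg : (fun i => Arrow.mk (g ((s ∘ ρ) (ρ.symm i)))) = fun i => Arrow.mk (g (s i)) :=
      funext fun i => congrArg (fun j => Arrow.mk (g (s j))) (ρ.apply_symm_apply i)
    rw [hg] at hψ
    refine (arrow_comp_congr hφ hψ).trans ?_
    exact congrArg Arrow.mk ((A.act n).map_comp _ _).symm

theorem inv {T T' : FTree ι} {x : ι → C} {X Y : C} {e : X ≅ Y}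
    (h : A.Realizes T T' (fun i => Arrow.mk (𝟙 (x i))) (Arrow.mk e.hom)) (hT' : T'.leaves.Nodup) :
    A.Realizes T' T (fun i => Arrow.mk (𝟙 (x i))) (Arrow.mk e.inv) := by
  obtain ⟨hT, n, p, p', s, rfl, rfl, hφ⟩ := h
  refine ⟨hT', n, p', p, s, rfl, rfl, ?_⟩
  let E : ((p, fun i => x (s i)) : ELZ.Y.Obj n × (Fin n → C)) ≅ (p', fun i => x (s i)) :=
    { hom := (yHom p p', 𝟙 _)
      inv := (yHom p' p, 𝟙 _)
      hom_inv_id := Prod.ext rfl (Category.id_comp _)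
      inv_hom_id := Prod.ext rfl (Category.id_comp _) }
  exact arrow_inv_congr (e' := (A.act n).mapIso E) hφ

theorem var (i : ι) (a : ι → Arrow C) : A.Realizes (.var i) (.var i) a (a i) :=
  ⟨List.nodup_singleton i, 1, ELZ.Y.one, ELZ.Y.one, fun _ => i, rfl, rfl,
    (A.actArrow_one fun _ => a i).symm⟩

/-- The presentations of the subwords are combined by operadic composition, input `(i, j)` being
labelled by `s i j`. Absence of repetitions is a separate hypothesis because different subwords
could share labels. -/
theorem bind {n : ℕ} (P P' : Y.Obj n) {T T' : Fin n → FTree ι} {a : ι → Arrow C}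
    {b : Fin n → Arrow C} (hT : ((yWord P).bind T).leaves.Nodup)
    (h : ∀ i, A.Realizes (T i) (T' i) a (b i)) :
    A.Realizes ((yWord P).bind T) ((yWord P').bind T') a (A.actArrow P P' b) := by
  choose _ k p p' s h₁ h₂ h₃ using h
  have hs (i : Fin n) (j : Fin (k i)) : s (finSigmaFinEquiv.symm (finSigmaFinEquiv ⟨i, j⟩)).1
      (finSigmaFinEquiv.symm (finSigmaFinEquiv ⟨i, j⟩)).2 = s i j :=
    congrArg (fun z : (i : Fin n) × Fin (k i) => s z.1 z.2)
      (finSigmaFinEquiv.symm_apply_apply ⟨i, j⟩)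
  refine ⟨hT, ∑ i, k i, (ELZ.Y.comp k).obj (P, p), (ELZ.Y.comp k).obj (P', p'),
    fun z => s (finSigmaFinEquiv.symm z).1 (finSigmaFinEquiv.symm z).2, ?_, ?_, ?_⟩
  · rw [yWord_comp, FTree.map, FTree.bind_bind]
    refine congrArg (FTree.bind _) (funext fun i => ?_)
    rw [h₁, FTree.map, FTree.map, FTree.bind_bind]
    refine congrArg (FTree.bind _) (funext fun j => ?_)
    exact congrArg FTree.var (hs i j).symm
  · rw [yWord_comp, FTree.map, FTree.bind_bind]
    refine congrArg (FTree.bind _) (funext fun i => ?_)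
    rw [h₂, FTree.map, FTree.map, FTree.bind_bind]
    refine congrArg (FTree.bind _) (funext fun j => ?_)
    exact congrArg FTree.var (hs i j).symm
  · rw [A.actArrow_comp]
    refine congrArg (A.actArrow P P') (funext fun i => ?_)
    rw [h₃]
    exact congrArg (A.actArrow _ _) (funext fun j => congrArg a (hs i j).symm)

end OperadAlgebra.Realizes

end ActArrow

/-! ### Structure morphisms that are read off from an action of `Y` -/

section ReadOff

variable {ι : Type} {C : Type u} [Category.{v} C]

/-- The product `((1,1), {1,2})`. -/
def yMul : Y.Obj 2 := yObj (.node .var .var) rfl 1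

/-- The unit object, the tensor product and the structure isomorphisms are given by the action
of `Y`.  In contrast to `IsReadOff`, no axioms of monoidal categories are assumed. -/
structure OperadAlgebra.ReadOff [MonoidalCategoryStruct C] (br : ∀ X Y : C, X ⊗ Y ≅ Y ⊗ X)
    (A : OperadAlgebra Y C) : Prop where
  unit : ∀ a : Fin 0 → Arrow C,
    Arrow.mk (𝟙 (𝟙_ C)) = A.actArrow (yObj .unit rfl 1) (yObj .unit rfl 1) a
  tensor : ∀ a b : Arrow C, Arrow.mk (a.hom ⊗ₘ b.hom) = A.actArrow yMul yMul ![a, b]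
  associator : ∀ X Y Z : C, Arrow.mk (α_ X Y Z).hom =
    A.actArrow (yObj (.node (.node .var .var) .var) rfl 1)
      (yObj (.node .var (.node .var .var)) rfl 1) ![Arrow.mk (𝟙 X), Arrow.mk (𝟙 Y), Arrow.mk (𝟙 Z)]
  rightUnitor : ∀ X : C, Arrow.mk (ρ_ X).hom =
    A.actArrow (yObj (.node .var .unit) rfl 1) (yObj .var rfl 1) ![Arrow.mk (𝟙 X)]
  leftUnitor : ∀ X : C, Arrow.mk (λ_ X).hom =
    A.actArrow (yObj (.node .unit .var) rfl 1) (yObj .var rfl 1) ![Arrow.mk (𝟙 X)]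
  braiding : ∀ X Y : C, Arrow.mk (br X Y).hom =
    A.actArrow yMul (yObj (n := 2) (.node .var .var) rfl (Equiv.swap 0 1))
      ![Arrow.mk (𝟙 X), Arrow.mk (𝟙 Y)]

variable {A : OperadAlgebra Y C}

namespace OperadAlgebra.ReadOff

variable [MonoidalCategoryStruct C] {br : ∀ X Y : C, X ⊗ Y ≅ Y ⊗ X}

/-- This and the next lemmas substitute realized subwords into a generating operation, here one
without inputs, by `Realizes.bind`. -/
theorem realizes_unit (hA : A.ReadOff br) (a : ι → Arrow C) :
    A.Realizes .unit .unit a (Arrow.mk (𝟙 (𝟙_ C))) := by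
  rw [hA.unit Fin.elim0]
  exact Realizes.bind (yObj .unit rfl 1) (yObj .unit rfl 1) (T := Fin.elim0) (T' := Fin.elim0)
    List.nodup_nil fun i => i.elim0

theorem realizes_tensor (hA : A.ReadOff br) {T T' U U' : FTree ι} {a : ι → Arrow C}
    {X X' Z Z' : C} {f : X ⟶ X'}
    {g : Z ⟶ Z'} (hT : (FTree.node T U).leaves.Nodup) (hf : A.Realizes T T' a (Arrow.mk f))
    (hg : A.Realizes U U' a (Arrow.mk g)) :
    A.Realizes (.node T U) (.node T' U') a (Arrow.mk (f ⊗ₘ g)) := by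
  rw [show Arrow.mk (f ⊗ₘ g) = _ from hA.tensor (Arrow.mk f) (Arrow.mk g)]
  exact Realizes.bind yMul yMul (T := ![T, U]) (T' := ![T', U']) hT
    fun | 0 => hf | 1 => hg

theorem realizes_associator (hA : A.ReadOff br) {T U V : FTree ι} {a : ι → Arrow C} {X X' X'' : C}
    (hT : (FTree.node (.node T U) V).leaves.Nodup) (h : A.Realizes T T a (Arrow.mk (𝟙 X)))
    (h' : A.Realizes U U a (Arrow.mk (𝟙 X'))) (h'' : A.Realizes V V a (Arrow.mk (𝟙 X''))) :
    A.Realizes (.node (.node T U) V) (.node T (.node U V)) a (Arrow.mk (α_ X X' X'').hom) := by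
  rw [hA.associator]
  exact Realizes.bind (yObj (n := 3) (.node (.node .var .var) .var) rfl 1)
    (yObj (.node .var (.node .var .var)) rfl 1) (T := ![T, U, V]) (T' := ![T, U, V]) hT
    fun | 0 => h | 1 => h' | 2 => h''

theorem realizes_leftUnitor (hA : A.ReadOff br) {T : FTree ι} {a : ι → Arrow C} {X : C}
    (h : A.Realizes T T a (Arrow.mk (𝟙 X))) :
    A.Realizes (.node .unit T) T a (Arrow.mk (λ_ X).hom) := by
  rw [hA.leftUnitor]
  exact Realizes.bind (yObj (n := 1) (.node .unit .var) rfl 1)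
    (yObj .var rfl 1) (T := ![T]) (T' := ![T]) h.1 fun | 0 => h

theorem realizes_rightUnitor (hA : A.ReadOff br) {T : FTree ι} {a : ι → Arrow C} {X : C}
    (h : A.Realizes T T a (Arrow.mk (𝟙 X))) :
    A.Realizes (.node T .unit) T a (Arrow.mk (ρ_ X).hom) := by
  rw [hA.rightUnitor]
  refine Realizes.bind (yObj (n := 1) (.node .var .unit) rfl 1)
    (yObj .var rfl 1) (T := ![T]) (T' := ![T]) ?_ fun | 0 => h
  change (T.leaves ++ []).Nodup
  rw [List.append_nil]
  exact h.1

theorem realizes_braiding (hA : A.ReadOff br) {T U : FTree ι} {a : ι → Arrow C} {X X' : C}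
    (hT : (FTree.node T U).leaves.Nodup) (h : A.Realizes T T a (Arrow.mk (𝟙 X)))
    (h' : A.Realizes U U a (Arrow.mk (𝟙 X'))) :
    A.Realizes (.node T U) (.node U T) a (Arrow.mk (br X X').hom) := by
  rw [hA.braiding]
  exact Realizes.bind yMul (yObj (n := 2) (.node .var .var) rfl (Equiv.swap 0 1))
    (T := ![T, U]) (T' := ![T, U]) hT fun | 0 => h | 1 => h'

end OperadAlgebra.ReadOff

/-! ### Uniqueness of the algebra from which a symmetric monoidal structure is read off -/

section Uniqueness

theorem OperadAlgebra.realizes_actArrow {n : ℕ} (p p' : Y.Obj n) (a : Fin n → Arrow C) :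
    A.Realizes (yWord p) (yWord p') a (A.actArrow p p' a) :=
  ⟨nodup_leaves_yWord p, n, p, p', fun i => i, (FTree.bind_var _).symm, (FTree.bind_var _).symm, rfl⟩

/-- Morphisms of `Y.Obj n` are unique, so `actArrow` contains the whole action; the axioms are
propositions. -/
theorem OperadAlgebra.ext_of_actArrow {A B : OperadAlgebra Y C}
    (h : ∀ (n : ℕ) (p p' : Y.Obj n) (a : Fin n → Arrow C), A.actArrow p p' a = B.actArrow p p' a) :
    A = B := by
  have hact : A.act = B.act := funext fun n => Arrow.functor_ext fun z z' φ =>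
    h n z.1 z'.1 fun i => Arrow.mk (φ.2 i)
  cases A
  cases B
  cases hact
  rfl

variable [MonoidalCategory C] [SymmetricCategory C]

theorem IsReadOff.readOff (hA : IsReadOff A) : A.ReadOff (fun X Y => β_ X Y) where
  unit a := by
    refine (arrow_id_congr (hA.unit fun i => (a i).left)).trans ?_
    refine (congrArg Arrow.mk ((A.act 0).map_id _).symm).trans ?_
    refine (A.mk_map_eq _ _).trans ?_
    exact congrArg (A.actArrow _ _) (funext fun i => i.elim0)
  tensor a b := hA.tensor (x := fun i => (![a, b] i).left) fun i => (![a, b] i).hom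
  associator X Y Z := by
    refine (hA.associator ![X, Y, Z]).trans ((A.mk_map_eq _ _).trans ?_)
    exact congrArg (A.actArrow _ _) (funext fun | 0 => rfl | 1 => rfl | 2 => rfl)
  rightUnitor X := by
    refine (hA.rightUnitor ![X]).trans ((A.mk_map_eq _ _).trans ?_)
    exact congrArg (A.actArrow _ _) (funext fun | 0 => rfl)
  leftUnitor X := by
    refine (hA.leftUnitor ![X]).trans ((A.mk_map_eq _ _).trans ?_)
    exact congrArg (A.actArrow _ _) (funext fun | 0 => rfl)
  braiding X Y := by
    refine (hA.braiding ![X, Y]).trans ((A.mk_map_eq _ _).trans ?_)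
    exact congrArg (A.actArrow _ _) (funext fun | 0 => rfl | 1 => rfl)

theorem OperadAlgebra.ReadOff.realizes_evalArrow
    (hA : A.ReadOff fun X Y => β_ X Y) {T : FTree ι} (hT : T.leaves.Nodup)
    (a : ι → Arrow C) : A.Realizes T T a (T.evalArrow a) := by
  induction T with
  | unit => exact hA.realizes_unit a
  | var i => exact .var i a
  | node T U ihT ihU =>
    have h := List.nodup_append.1 hT
    exact hA.realizes_tensor hT (ihT h.1) (ihU h.2.1)

theorem OperadAlgebra.ReadOff.realizes_id
    (hA : A.ReadOff fun X Y => β_ X Y) {T : FTree ι} (hT : T.leaves.Nodup) (x : ι → C) :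
    A.Realizes T T (fun i => Arrow.mk (𝟙 (x i))) (Arrow.mk (𝟙 (T.eval x))) := by
  rw [← T.evalMap_id x]
  exact hA.realizes_evalArrow hT _

/-- The action on the generating isomorphisms forces the action on all formal composites of them. -/
theorem OperadAlgebra.ReadOff.realizes_eval
    (hA : A.ReadOff fun X Y => β_ X Y) {T T' : FTree ι} (f : FHom T T') (hT : T.leaves.Nodup)
    (x : ι → C) :
    A.Realizes T T' (fun i => Arrow.mk (𝟙 (x i))) (Arrow.mk (f.eval x).hom) := by
  induction f with
  | refl T => exact hA.realizes_id hT x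
  | symm f ih => exact (ih (f.leaves_perm.nodup_iff.2 hT)).inv hT
  | trans f g ih ih' =>
    have := (ih hT).comp (ih' (f.leaves_perm.nodup_iff.1 hT))
    simp only [Category.comp_id] at this
    exact this
  | tensor f g ih ih' =>
    have h := List.nodup_append.1 hT
    exact hA.realizes_tensor hT (ih h.1) (ih' h.2.1)
  | assoc T U V =>
    have h := List.nodup_append.1 hT
    have h' := List.nodup_append.1 h.1
    exact hA.realizes_associator hT (hA.realizes_id h'.1 x) (hA.realizes_id h'.2.1 x)
      (hA.realizes_id h.2.1 x)
  | lUnit T => exact hA.realizes_leftUnitor (hA.realizes_id (T := T) hT x)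
  | rUnit T => exact hA.realizes_rightUnitor (hA.realizes_id (List.nodup_append.1 hT).1 x)
  | braid T U =>
    have h := List.nodup_append.1 hT
    exact hA.realizes_braiding hT (hA.realizes_id h.1 x) (hA.realizes_id h.2.1 x)

/-- The action of `p ⟶ p'` on arrows and the composite that defines `symmMonAlgebra` realize the
same pair of words at the same arrows. -/
theorem OperadAlgebra.ReadOff.eq_symmMonAlgebra (hA : A.ReadOff fun X Y => β_ X Y) :
    A = symmMonAlgebra C := by
  refine OperadAlgebra.ext_of_actArrow fun n p p' a => ?_
  refine (A.realizes_actArrow p p' a).unique ?_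
  have := (hA.realizes_eval (yFHom p p') (nodup_leaves_yWord p) fun i => (a i).left).comp
    (f := fun i => 𝟙 _) (g := fun i => (a i).hom)
    (hA.realizes_evalArrow (nodup_leaves_yWord p') a)
  have ha : (fun i => Arrow.mk (𝟙 (a i).left ≫ (a i).hom)) = a :=
    funext fun i => congrArg Arrow.mk (Category.id_comp _)
  rw [ha] at this
  exact this

/-- By coherence the action may be computed with any formal isomorphism, in particular with the
single structure isomorphism that is to be read off. -/
theorem arrow_symmMonAlgebra_map {n : ℕ} {p p' : Y.Obj n} (f : FHom (yWord p) (yWord p'))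
    (x : Fin n → C) :
    Arrow.mk (f.eval x).hom = Arrow.mk (((symmMonAlgebra C).act n).map
      ((yHom p p', 𝟙 x) : (p, x) ⟶ (p', x))) := by
  refine Eq.symm ((FHom.arrow_eval_congr rfl rfl (nodup_leaves_yWord p) (yFHom p p') f
    fun i => 𝟙 (x i)).trans ?_)
  rw [FTree.evalMap_id, Category.comp_id]

theorem isReadOff_symmMonAlgebra : IsReadOff (symmMonAlgebra C) where
  unit x := rfl
  tensor h := by
    refine Eq.symm (FHom.arrow_eval_congr rfl rfl (nodup_leaves_yWord _) _ (.refl _) h |>.trans ?_)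
    exact congrArg Arrow.mk (Category.id_comp _)
  associator x := arrow_symmMonAlgebra_map
    (p := yObj (n := 3) (.node (.node .var .var) .var) rfl 1)
    (p' := yObj (n := 3) (.node .var (.node .var .var)) rfl 1) (.assoc _ _ _) x
  rightUnitor x := arrow_symmMonAlgebra_map (p := yObj (n := 1) (.node .var .unit) rfl 1)
    (p' := yObj .var rfl 1) (.rUnit (.var 0)) x
  leftUnitor x := arrow_symmMonAlgebra_map (p := yObj (n := 1) (.node .unit .var) rfl 1)
    (p' := yObj .var rfl 1) (.lUnit (.var 0)) x
  braiding x := arrow_symmMonAlgebra_map (p := yObj (n := 2) (.node .var .var) rfl 1)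
    (p' := yObj (n := 2) (.node .var .var) rfl (Equiv.swap 0 1)) (.braid (.var 0) (.var 1)) x

end Uniqueness

end ReadOff

/-! ### The symmetric monoidal structure of a `Y`-algebra -/

section Realizes

variable {ι : Type} {C : Type u} [Category.{v} C] {A : OperadAlgebra Y C}

namespace OperadAlgebra.Realizes

/-- For naturality squares: one factor carries the given arrows, the other only identities. -/
theorem comp_right {T T' T'' : FTree ι} {a : ι → Arrow C} {X X' X'' : C} {φ : X ⟶ X'}
    {ψ : X' ⟶ X''} (h : A.Realizes T T' a (Arrow.mk φ))
    (h' : A.Realizes T' T'' (fun i => Arrow.mk (𝟙 (a i).right)) (Arrow.mk ψ)) :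
    A.Realizes T T'' a (Arrow.mk (φ ≫ ψ)) := by
  have := Realizes.comp (f := fun i => (a i).hom) h h'
  simp only [Category.comp_id] at this
  exact this

theorem comp_left {T T' T'' : FTree ι} {a : ι → Arrow C} {X X' X'' : C} {φ : X ⟶ X'}
    {ψ : X' ⟶ X''} (h : A.Realizes T T' (fun i => Arrow.mk (𝟙 (a i).left)) (Arrow.mk φ))
    (h' : A.Realizes T' T'' a (Arrow.mk ψ)) :
    A.Realizes T T'' a (Arrow.mk (φ ≫ ψ)) := by
  have := Realizes.comp (g := fun i => (a i).hom) h h'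
  simp only [Category.id_comp] at this
  exact this

theorem comp_id {T T' T'' : FTree ι} {x : ι → C} {X X' X'' : C} {φ : X ⟶ X'}
    {ψ : X' ⟶ X''} (h : A.Realizes T T' (fun i => Arrow.mk (𝟙 (x i))) (Arrow.mk φ))
    (h' : A.Realizes T' T'' (fun i => Arrow.mk (𝟙 (x i))) (Arrow.mk ψ)) :
    A.Realizes T T'' (fun i => Arrow.mk (𝟙 (x i))) (Arrow.mk (φ ≫ ψ)) :=
  h.comp_right h'

/-- All axioms of a symmetric monoidal category are obtained from this: both sides realize the same
pair of words at the same arrows. -/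
theorem hom_eq {T T' : FTree ι} {a : ι → Arrow C} {X X' : C} {φ ψ : X ⟶ X'}
    (h : A.Realizes T T' a (Arrow.mk φ)) (h' : A.Realizes T T' a (Arrow.mk ψ)) : φ = ψ :=
  Arrow.mk_injective _ _ (h.unique h')

end OperadAlgebra.Realizes

end Realizes

section Construction

variable {C : Type u} [Category.{v} C] (A : OperadAlgebra Y C)

namespace OperadAlgebra

/-- The unit object of a `Y`-algebra. -/
def unitObj : C := (A.act 0).obj (yObj .unit rfl 1, Fin.elim0)

/-- The product of two objects of a `Y`-algebra. -/
def mulObj (X X' : C) : C := (A.act 2).obj (yMul, ![X, X'])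

/-- The product of two morphisms of a `Y`-algebra. -/
def mulHom {X X' Z Z' : C} (f : X ⟶ Z) (g : X' ⟶ Z') : A.mulObj X X' ⟶ A.mulObj Z Z' :=
  (A.act 2).map ((yHom yMul yMul, fun | 0 => f | 1 => g) : (yMul, ![X, X']) ⟶ (yMul, ![Z, Z']))

theorem mk_mulHom {X X' Z Z' : C} (f : X ⟶ Z) (g : X' ⟶ Z') :
    Arrow.mk (A.mulHom f g) = A.actArrow yMul yMul ![Arrow.mk f, Arrow.mk g] :=
  (A.mk_map_eq _ _).trans (congrArg (A.actArrow _ _) (funext fun | 0 => rfl | 1 => rfl))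

theorem mulHom_id (X X' : C) : A.mulHom (𝟙 X) (𝟙 X') = 𝟙 (A.mulObj X X') := by
  refine Eq.trans (congrArg (A.act 2).map ?_) ((A.act 2).map_id _)
  exact Prod.ext rfl (funext fun | 0 => rfl | 1 => rfl)

theorem mulHom_comp {X X' Z Z' W W' : C} (f : X ⟶ Z) (f' : X' ⟶ Z') (g : Z ⟶ W) (g' : Z' ⟶ W') :
    A.mulHom f f' ≫ A.mulHom g g' = A.mulHom (f ≫ g) (f' ≫ g') := by
  refine ((A.act 2).map_comp _ _).symm.trans (congrArg (A.act 2).map ?_)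
  exact Prod.ext rfl (funext fun | 0 => rfl | 1 => rfl)

theorem mk_id_unitObj (a : Fin 0 → Arrow C) :
    Arrow.mk (𝟙 A.unitObj) = A.actArrow (yObj .unit rfl 1) (yObj .unit rfl 1) a := by
  refine (congrArg Arrow.mk ((A.act 0).map_id _).symm).trans ((A.mk_map_eq _ _).trans ?_)
  exact congrArg (A.actArrow _ _) (funext fun i => i.elim0)

variable {A} in
theorem Realizes.mulHom {ι : Type} {T T' U U' : FTree ι} {a : ι → Arrow C} {X X' Z Z' : C}
    {f : X ⟶ X'} {g : Z ⟶ Z'} (hf : A.Realizes T T' a (Arrow.mk f))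
    (hg : A.Realizes U U' a (Arrow.mk g)) (hT : (FTree.node T U).leaves.Nodup) :
    A.Realizes (.node T U) (.node T' U') a (Arrow.mk (A.mulHom f g)) := by
  rw [A.mk_mulHom f g]
  exact Realizes.bind yMul yMul (T := ![T, U]) (T' := ![T', U']) hT
    fun | 0 => hf | 1 => hg

theorem realizes_unitObj {ι : Type} (a : ι → Arrow C) :
    A.Realizes .unit .unit a (Arrow.mk (𝟙 A.unitObj)) := by
  rw [A.mk_id_unitObj Fin.elim0]
  exact Realizes.bind (yObj .unit rfl 1) (yObj .unit rfl 1) (T := Fin.elim0) (T' := Fin.elim0)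
    List.nodup_nil fun i => i.elim0

/-- The isomorphism between two objects that are given by the action of operations of `Y`. -/
def actIso {n : ℕ} (p p' : Y.Obj n) (a : Fin n → Arrow C) {X X' : C}
    (h : X = (A.actArrow p p fun i => Arrow.mk (𝟙 (a i).left)).left)
    (h' : X' = (A.actArrow p' p' fun i => Arrow.mk (𝟙 (a i).left)).left) : X ≅ X' :=
  eqToIso h ≪≫ (A.act n).mapIso (X := (p, fun i => (a i).left)) (Y := (p', fun i => (a i).left))
    { hom := (yHom p p', 𝟙 _)
      inv := (yHom p' p, 𝟙 _)
      hom_inv_id := Prod.ext rfl (Category.id_comp _)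
      inv_hom_id := Prod.ext rfl (Category.id_comp _) } ≪≫ eqToIso h'.symm

theorem mk_actIso_hom {n : ℕ} (p p' : Y.Obj n) (a : Fin n → Arrow C) {X X' : C}
    (h : X = (A.actArrow p p fun i => Arrow.mk (𝟙 (a i).left)).left)
    (h' : X' = (A.actArrow p' p' fun i => Arrow.mk (𝟙 (a i).left)).left) :
    Arrow.mk (A.actIso p p' a h h').hom =
      A.actArrow p p' fun i => Arrow.mk (𝟙 (a i).left) := by
  subst h h'
  refine congrArg Arrow.mk ?_
  exact (Category.id_comp _).trans (Category.comp_id _)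

/-- Identifies an iterated product with the object given by a single operation, as `actIso`
requires. Only the source of `φ` matters. -/
theorem left_eq_of_realizes {n : ℕ} (p : Y.Obj n) (a : Fin n → Arrow C) {X : C} {φ : X ⟶ X}
    (h : A.Realizes (yWord p) (yWord p) a (Arrow.mk φ)) : X = (A.actArrow p p a).left :=
  congrArg Arrow.left (h.unique (A.realizes_actArrow p p a))

/-- The unit object, the product and the structure isomorphisms of a `Y`-algebra. -/
@[reducible]
def monoidalStruct : MonoidalCategoryStruct C where
  tensorObj := A.mulObj
  whiskerLeft X _ _ f := A.mulHom (𝟙 X) f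
  whiskerRight f X := A.mulHom f (𝟙 X)
  tensorHom := A.mulHom
  tensorUnit := A.unitObj
  associator X X' X'' :=
    let a : Fin 3 → Arrow C := ![Arrow.mk (𝟙 X), Arrow.mk (𝟙 X'), Arrow.mk (𝟙 X'')]
    let v := fun i => Realizes.var (A := A) i fun i => Arrow.mk (𝟙 (a i).left)
    A.actIso (yObj (n := 3) (.node (.node .var .var) .var) rfl 1)
      (yObj (.node .var (.node .var .var)) rfl 1) a
      -- The two iterated products are the values of the two ternary operations; `decide` checks
      -- that the labels in `Fin 3` are distinct.
      (A.left_eq_of_realizes _ _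
        (((v 0).mulHom (v 1) (by decide)).mulHom (v 2) (by decide)))
      (A.left_eq_of_realizes _ _
        ((v 0).mulHom ((v 1).mulHom (v 2) (by decide)) (by decide)))
  leftUnitor X :=
    let a : Fin 1 → Arrow C := ![Arrow.mk (𝟙 X)]
    let v := fun i => Realizes.var (A := A) i fun i => Arrow.mk (𝟙 (a i).left)
    A.actIso (yObj (n := 1) (.node .unit .var) rfl 1) (yObj .var rfl 1) a
      (A.left_eq_of_realizes _ _ ((A.realizes_unitObj _).mulHom (v 0) (by decide)))
      (A.left_eq_of_realizes _ _ (v 0))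
  rightUnitor X :=
    let a : Fin 1 → Arrow C := ![Arrow.mk (𝟙 X)]
    let v := fun i => Realizes.var (A := A) i fun i => Arrow.mk (𝟙 (a i).left)
    A.actIso (yObj (n := 1) (.node .var .unit) rfl 1) (yObj .var rfl 1) a
      (A.left_eq_of_realizes _ _ ((v 0).mulHom (A.realizes_unitObj _) (by decide)))
      (A.left_eq_of_realizes _ _ (v 0))

/-- The symmetry of a `Y`-algebra. -/
@[reducible]
def mulBraiding (X X' : C) : A.mulObj X X' ≅ A.mulObj X' X :=
  let a : Fin 2 → Arrow C := ![Arrow.mk (𝟙 X), Arrow.mk (𝟙 X')]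
  let v := fun i => Realizes.var (A := A) i fun i => Arrow.mk (𝟙 (a i).left)
  A.actIso yMul (yObj (n := 2) (.node .var .var) rfl (Equiv.swap 0 1)) a
    (A.left_eq_of_realizes _ _ ((v 0).mulHom (v 1) (by decide)))
    (A.left_eq_of_realizes _ _ ((v 1).mulHom (v 0) (by decide)))

theorem readOff : letI := A.monoidalStruct; A.ReadOff A.mulBraiding :=
  letI := A.monoidalStruct
  { unit := A.mk_id_unitObj
    tensor := fun a b => A.mk_mulHom a.hom b.hom
    associator := fun _ _ _ => (A.mk_actIso_hom _ _ _ _ _).trans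
      (congrArg (A.actArrow _ _) (funext fun | 0 => rfl | 1 => rfl | 2 => rfl))
    rightUnitor := fun _ => (A.mk_actIso_hom _ _ _ _ _).trans
      (congrArg (A.actArrow _ _) (funext fun | 0 => rfl))
    leftUnitor := fun _ => (A.mk_actIso_hom _ _ _ _ _).trans
      (congrArg (A.actArrow _ _) (funext fun | 0 => rfl))
    braiding := fun _ _ => (A.mk_actIso_hom _ _ _ _ _).trans
      (congrArg (A.actArrow _ _) (funext fun | 0 => rfl | 1 => rfl)) }

end OperadAlgebra

end Construction

section Construction

variable {C : Type u} [Category.{v} C] (A : OperadAlgebra Y C)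

namespace OperadAlgebra

/-- Allows a product to be one of the arguments of an associator or a symmetry, as in the pentagon
and the hexagons. -/
theorem ReadOff.realizes_id_tensorObj {A : OperadAlgebra Y C} {ι : Type} {T U : FTree ι}
    {a : ι → Arrow C} {X X' : C} (hT : (FTree.node T U).leaves.Nodup)
    (hX : A.Realizes T T a (Arrow.mk (𝟙 X))) (hX' : A.Realizes U U a (Arrow.mk (𝟙 X'))) :
    A.Realizes (.node T U) (.node T U) a (Arrow.mk (𝟙 (A.mulObj X X'))) := by
  rw [← A.mulHom_id]
  exact hX.mulHom hX' hT

/-- The monoidal category given by a `Y`-algebra. -/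
@[reducible]
def monoidalCategory : MonoidalCategory C :=
  letI := A.monoidalStruct
  MonoidalCategory.ofTensorHom
    (id_tensorHom_id := A.mulHom_id)
    (id_tensorHom := fun _ _ _ _ => rfl)
    (tensorHom_id := fun _ _ => rfl)
    (tensorHom_comp_tensorHom := fun f₁ f₂ g₁ g₂ => A.mulHom_comp f₁ f₂ g₁ g₂)
    (associator_naturality := fun f g h => by
      let a : Fin 3 → Arrow C := ![Arrow.mk f, Arrow.mk g, Arrow.mk h]
      have v := fun i => Realizes.var (A := A) i a
      have l := fun i => Realizes.var (A := A) i fun i => Arrow.mk (𝟙 (a i).left)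
      have r := fun i => Realizes.var (A := A) i fun i => Arrow.mk (𝟙 (a i).right)
      -- Both sides realize the pair `(ab)c`, `a(bc)` at the arrows `f`, `g`, `h`.
      exact ((((v 0).mulHom (v 1) (by decide)).mulHom (v 2) (by decide)).comp_right
        (A.readOff.realizes_associator (by decide) (r 0) (r 1) (r 2))).hom_eq
        ((A.readOff.realizes_associator (by decide) (l 0) (l 1) (l 2)).comp_left
          ((v 0).mulHom ((v 1).mulHom (v 2) (by decide)) (by decide))))
    (leftUnitor_naturality := fun f => by
      let a : Fin 1 → Arrow C := ![Arrow.mk f]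
      have v := fun i => Realizes.var (A := A) i a
      have l := fun i => Realizes.var (A := A) i fun i => Arrow.mk (𝟙 (a i).left)
      have r := fun i => Realizes.var (A := A) i fun i => Arrow.mk (𝟙 (a i).right)
      exact (((A.realizes_unitObj a).mulHom (v 0) (by decide)).comp_right
        (A.readOff.realizes_leftUnitor (r 0))).hom_eq
        ((A.readOff.realizes_leftUnitor (l 0)).comp_left (v 0)))
    (rightUnitor_naturality := fun f => by
      let a : Fin 1 → Arrow C := ![Arrow.mk f]
      have v := fun i => Realizes.var (A := A) i a
      have l := fun i => Realizes.var (A := A) i fun i => Arrow.mk (𝟙 (a i).left)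
      have r := fun i => Realizes.var (A := A) i fun i => Arrow.mk (𝟙 (a i).right)
      exact (((v 0).mulHom (A.realizes_unitObj a) (by decide)).comp_right
        (A.readOff.realizes_rightUnitor (r 0))).hom_eq
        ((A.readOff.realizes_rightUnitor (l 0)).comp_left (v 0)))
    (pentagon := fun W X X' X'' => by
      -- The labels are the four indices, which are distinct even if some of the objects coincide.
      let x : Fin 4 → C := ![W, X, X', X'']
      have v := fun i => Realizes.var (A := A) i fun i => Arrow.mk (𝟙 (x i))
      exact (((A.readOff.realizes_associator (by decide) (v 0) (v 1) (v 2)).mulHom (v 3)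
        (by decide)).comp_id ((A.readOff.realizes_associator (by decide) (v 0)
          (ReadOff.realizes_id_tensorObj (by decide) (v 1) (v 2)) (v 3)).comp_id
        ((v 0).mulHom (A.readOff.realizes_associator (by decide) (v 1) (v 2) (v 3))
          (by decide)))).hom_eq
        ((A.readOff.realizes_associator (by decide)
          (ReadOff.realizes_id_tensorObj (by decide) (v 0) (v 1)) (v 2) (v 3)).comp_id
          (A.readOff.realizes_associator (by decide) (v 0) (v 1)
            (ReadOff.realizes_id_tensorObj (by decide) (v 2) (v 3)))))
    (triangle := fun X X' => by
      let x : Fin 2 → C := ![X, X']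
      have v := fun i => Realizes.var (A := A) i fun i => Arrow.mk (𝟙 (x i))
      exact ((A.readOff.realizes_associator (by decide) (v 0) (A.realizes_unitObj _) (v 1)).comp_id
        ((v 0).mulHom (A.readOff.realizes_leftUnitor (v 1)) (by decide))).hom_eq
        ((A.readOff.realizes_rightUnitor (v 0)).mulHom (v 1) (by decide)))

/-- The symmetric monoidal category given by a `Y`-algebra. -/
@[reducible]
def symmetricCategory : letI := A.monoidalCategory; SymmetricCategory C :=
  letI := A.monoidalCategory
  { braiding := A.mulBraiding
    braiding_naturality_right := fun X _ _ f => by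
      let a : Fin 2 → Arrow C := ![Arrow.mk (𝟙 X), Arrow.mk f]
      have v := fun i => Realizes.var (A := A) i a
      have l := fun i => Realizes.var (A := A) i fun i => Arrow.mk (𝟙 (a i).left)
      have r := fun i => Realizes.var (A := A) i fun i => Arrow.mk (𝟙 (a i).right)
      exact (((v 0).mulHom (v 1) (by decide)).comp_right
        (A.readOff.realizes_braiding (by decide) (r 0) (r 1))).hom_eq
        ((A.readOff.realizes_braiding (by decide) (l 0) (l 1)).comp_left
          ((v 1).mulHom (v 0) (by decide)))
    braiding_naturality_left := fun f X => by
      let a : Fin 2 → Arrow C := ![Arrow.mk f, Arrow.mk (𝟙 X)]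
      have v := fun i => Realizes.var (A := A) i a
      have l := fun i => Realizes.var (A := A) i fun i => Arrow.mk (𝟙 (a i).left)
      have r := fun i => Realizes.var (A := A) i fun i => Arrow.mk (𝟙 (a i).right)
      exact (((v 0).mulHom (v 1) (by decide)).comp_right
        (A.readOff.realizes_braiding (by decide) (r 0) (r 1))).hom_eq
        ((A.readOff.realizes_braiding (by decide) (l 0) (l 1)).comp_left
          ((v 1).mulHom (v 0) (by decide)))
    hexagon_forward := fun X X' X'' => by
      let x : Fin 3 → C := ![X, X', X'']
      have v := fun i => Realizes.var (A := A) i fun i => Arrow.mk (𝟙 (x i))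
      exact ((A.readOff.realizes_associator (by decide) (v 0) (v 1) (v 2)).comp_id
        ((A.readOff.realizes_braiding (by decide) (v 0)
          (ReadOff.realizes_id_tensorObj (by decide) (v 1) (v 2))).comp_id
          (A.readOff.realizes_associator (by decide) (v 1) (v 2) (v 0)))).hom_eq
        (((A.readOff.realizes_braiding (by decide) (v 0) (v 1)).mulHom (v 2) (by decide)).comp_id
          ((A.readOff.realizes_associator (by decide) (v 1) (v 0) (v 2)).comp_id
            ((v 1).mulHom (A.readOff.realizes_braiding (by decide) (v 0) (v 2)) (by decide))))
    hexagon_reverse := fun X X' X'' => by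
      let x : Fin 3 → C := ![X, X', X'']
      have v := fun i => Realizes.var (A := A) i fun i => Arrow.mk (𝟙 (x i))
      exact (((A.readOff.realizes_associator (by decide) (v 0) (v 1) (v 2)).inv (by decide)).comp_id
        ((A.readOff.realizes_braiding (by decide)
          (ReadOff.realizes_id_tensorObj (by decide) (v 0) (v 1)) (v 2)).comp_id
          ((A.readOff.realizes_associator (by decide) (v 2) (v 0) (v 1)).inv (by decide)))).hom_eq
        (((v 0).mulHom (A.readOff.realizes_braiding (by decide) (v 1) (v 2)) (by decide)).comp_id
          (((A.readOff.realizes_associator (by decide) (v 0) (v 2) (v 1)).inv (by decide)).comp_id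
            ((A.readOff.realizes_braiding (by decide) (v 0) (v 2)).mulHom (v 1) (by decide))))
    symmetry := fun X X' => by
      let x : Fin 2 → C := ![X, X']
      have v := fun i => Realizes.var (A := A) i fun i => Arrow.mk (𝟙 (x i))
      exact ((A.readOff.realizes_braiding (by decide) (v 0) (v 1)).comp_id
        (A.readOff.realizes_braiding (by decide) (v 1) (v 0))).hom_eq
        (ReadOff.realizes_id_tensorObj (by decide) (v 0) (v 1)) }

/-- The symmetric monoidal structure given by a `Y`-algebra. -/
def symmMonStructure : SymmMonStructure C :=
  letI := A.monoidalCategory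
  letI := A.symmetricCategory
  ⟨⟩

end OperadAlgebra

/-! ### The bijection -/

/-- The structure `M` is read off from the `Y`-algebra structure `A`. -/
def SymmMonStructure.IsOf {C : Type u} [Category.{v} C] (M : SymmMonStructure C)
    (A : OperadAlgebra Y C) : Prop :=
  letI := M.monoidal
  letI := M.symmetric
  A.ReadOff fun X Y => β_ X Y

theorem OperadAlgebra.isOf_symmMonStructure : A.symmMonStructure.IsOf A := A.readOff

/-- Unit and product on objects are identified first; after that the remaining data have the same
types, and equal arrows give equal morphisms. -/
theorem MonoidalCategoryStruct.ext_of_arrow {S S' : MonoidalCategoryStruct C}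
    (hu : S.tensorUnit = S'.tensorUnit) (ho : ∀ X Y, S.tensorObj X Y = S'.tensorObj X Y)
    (hl : ∀ (X) {Y Y' : C} (f : Y ⟶ Y'),
      Arrow.mk (S.whiskerLeft X f) = Arrow.mk (S'.whiskerLeft X f))
    (hr : ∀ {Y Y' : C} (f : Y ⟶ Y') (X),
      Arrow.mk (S.whiskerRight f X) = Arrow.mk (S'.whiskerRight f X))
    (ht : ∀ {X X' Y Y' : C} (f : X ⟶ X') (g : Y ⟶ Y'),
      Arrow.mk (S.tensorHom f g) = Arrow.mk (S'.tensorHom f g))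
    (ha : ∀ X Y Z, Arrow.mk (S.associator X Y Z).hom = Arrow.mk (S'.associator X Y Z).hom)
    (hlu : ∀ X, Arrow.mk (S.leftUnitor X).hom = Arrow.mk (S'.leftUnitor X).hom)
    (hru : ∀ X, Arrow.mk (S.rightUnitor X).hom = Arrow.mk (S'.rightUnitor X).hom) :
    S = S' := by
  obtain ⟨o, l, r, t, e, a, lu, ru⟩ := S
  obtain ⟨o', l', r', t', e', a', lu', ru'⟩ := S'
  obtain rfl : o = o' := funext fun X => funext fun Y => ho X Y
  obtain rfl : e = e' := hu
  obtain rfl : @l = @l' := by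
    funext X Y Y' f
    exact Arrow.mk_injective _ _ (hl X f)
  obtain rfl : @r = @r' := by
    funext Y Y' f X
    exact Arrow.mk_injective _ _ (hr f X)
  obtain rfl : @t = @t' := by
    funext X X' Y Y' f g
    exact Arrow.mk_injective _ _ (ht f g)
  obtain rfl : a = a' := by
    funext X Y Z
    exact Iso.ext (Arrow.mk_injective _ _ (ha X Y Z))
  obtain rfl : lu = lu' := by
    funext X
    exact Iso.ext (Arrow.mk_injective _ _ (hlu X))
  obtain rfl : ru = ru' := by
    funext X
    exact Iso.ext (Arrow.mk_injective _ _ (hru X))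
  rfl

/-- Every piece of data is prescribed by `A`; the whiskerings are tensor products with an identity.
-/
theorem SymmMonStructure.eq_of_isOf {A : OperadAlgebra Y C} {M M' : SymmMonStructure C}
    (h : M.IsOf A) (h' : M'.IsOf A) : M = M' := by
  let S := M.monoidal.toMonoidalCategoryStruct
  let S' := M'.monoidal.toMonoidalCategoryStruct
  have hS : M.monoidal.toMonoidalCategoryStruct = M'.monoidal.toMonoidalCategoryStruct := by
    have ht {X X' Y Y' : C} (f : X ⟶ X') (g : Y ⟶ Y') :
        Arrow.mk (M.monoidal.tensorHom f g) = Arrow.mk (M'.monoidal.tensorHom f g) :=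
      (@OperadAlgebra.ReadOff.tensor _ _ S _ _ h (Arrow.mk f) (Arrow.mk g)).trans
        (@OperadAlgebra.ReadOff.tensor _ _ S' _ _ h' (Arrow.mk f) (Arrow.mk g)).symm
    refine MonoidalCategoryStruct.ext_of_arrow ?_ ?_ ?_ ?_ ht ?_ ?_ ?_
    · exact congrArg Arrow.left ((@OperadAlgebra.ReadOff.unit _ _ S _ _ h Fin.elim0).trans
        (@OperadAlgebra.ReadOff.unit _ _ S' _ _ h' Fin.elim0).symm)
    · exact fun X Y => congrArg Arrow.left (ht (𝟙 X) (𝟙 Y))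
    · intro X Y Y' f
      have := ht (𝟙 X) f
      rwa [@MonoidalCategory.id_tensorHom _ _ M.monoidal,
        @MonoidalCategory.id_tensorHom _ _ M'.monoidal] at this
    · intro Y Y' f X
      have := ht f (𝟙 X)
      rwa [@MonoidalCategory.tensorHom_id _ _ M.monoidal,
        @MonoidalCategory.tensorHom_id _ _ M'.monoidal] at this
    · exact fun X Y Z => (@OperadAlgebra.ReadOff.associator _ _ S _ _ h X Y Z).trans
        (@OperadAlgebra.ReadOff.associator _ _ S' _ _ h' X Y Z).symm
    · exact fun X => (@OperadAlgebra.ReadOff.leftUnitor _ _ S _ _ h X).trans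
        (@OperadAlgebra.ReadOff.leftUnitor _ _ S' _ _ h' X).symm
    · exact fun X => (@OperadAlgebra.ReadOff.rightUnitor _ _ S _ _ h X).trans
        (@OperadAlgebra.ReadOff.rightUnitor _ _ S' _ _ h' X).symm
  have hb (X Y : C) :
      Arrow.mk (@BraidedCategory.braiding C _ M.monoidal M.symmetric.toBraidedCategory X Y).hom =
        Arrow.mk
          (@BraidedCategory.braiding C _ M'.monoidal M'.symmetric.toBraidedCategory X Y).hom :=
    (@OperadAlgebra.ReadOff.braiding _ _ S _ _ h X Y).trans
        (@OperadAlgebra.ReadOff.braiding _ _ S' _ _ h' X Y).symm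
  clear S S' h h'
  -- Apart from the data `S` and `b` the structures consist of axioms, so nothing else has to be
  -- compared.
  obtain @⟨@⟨S⟩, @⟨@⟨b⟩⟩⟩ := M
  obtain @⟨@⟨S'⟩, @⟨@⟨b'⟩⟩⟩ := M'
  obtain rfl : S = S' := hS
  obtain rfl : b = b' := by
    funext X Y
    exact Iso.ext (Arrow.mk_injective _ _ (hb X Y))
  rfl

/-- The `Y`-algebra given by a symmetric monoidal structure. -/
noncomputable def SymmMonStructure.algebra (M : SymmMonStructure C) : OperadAlgebra Y C :=
  letI := M.monoidal
  letI := M.symmetric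
  symmMonAlgebra C

theorem SymmMonStructure.corresponds_algebra (M : SymmMonStructure C) :
    Corresponds M M.algebra :=
  letI := M.monoidal
  letI := M.symmetric
  isReadOff_symmMonAlgebra

theorem SymmMonStructure.isOf_algebra (M : SymmMonStructure C) : M.IsOf M.algebra :=
  letI := M.monoidal
  letI := M.symmetric
  isReadOff_symmMonAlgebra.readOff

theorem SymmMonStructure.IsOf.eq_algebra {M : SymmMonStructure C} {A : OperadAlgebra Y C}
    (h : M.IsOf A) : A = M.algebra :=
  letI := M.monoidal
  letI := M.symmetric
  OperadAlgebra.ReadOff.eq_symmMonAlgebra h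

/-- Symmetric monoidal structures are the same as `Y`-algebra structures. -/
noncomputable def symmMonEquiv (C : Type u) [Category.{v} C] :
    SymmMonStructure C ≃ OperadAlgebra Y C where
  toFun M := M.algebra
  invFun A := A.symmMonStructure
  -- Both structures are read off from `M.algebra`.
  left_inv M := SymmMonStructure.eq_of_isOf M.algebra.isOf_symmMonStructure M.isOf_algebra
  right_inv A := A.isOf_symmMonStructure.eq_algebra.symm

end Construction

/-! ### Strict maps -/

section Maps

variable {ι : Type} {C D : Type u} [Category.{v} C] [Category.{v} D]

theorem map_actArrow {A : OperadAlgebra Y C} {B : OperadAlgebra Y D} {F : C ⥤ D}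
    (hF : A.IsMap B F) {n : ℕ} (p p' : Y.Obj n) (a : Fin n → Arrow C) :
    F.mapArrow.obj (A.actArrow p p' a) = B.actArrow p p' fun i => F.mapArrow.obj (a i) :=
  hF.map_act (yHom p p') fun i => (a i).hom

theorem map_mk_id (F : C ⥤ D) (X : C) :
    F.mapArrow.obj (Arrow.mk (𝟙 X)) = Arrow.mk (𝟙 (F.obj X)) :=
  congrArg Arrow.mk (F.map_id X)

variable [MonoidalCategory C] [SymmetricCategory C] [MonoidalCategory D] [SymmetricCategory D]

/-- The structure of `C` and that of `D` are actions of the same morphisms of `Y`, and `F` commutes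
with these. -/
theorem OperadAlgebra.IsMap.isStrictSymmMon {A : OperadAlgebra Y C} {B : OperadAlgebra Y D}
    {F : C ⥤ D} (hF : A.IsMap B F) (hA : A.ReadOff fun X Y => β_ X Y)
    (hB : B.ReadOff fun X Y => β_ X Y) : IsStrictSymmMon F where
  unit := by
    have h := (congrArg F.mapArrow.obj (hA.unit Fin.elim0)).trans (map_actArrow hF _ _ _)
    exact congrArg Arrow.left (h.trans (hB.unit _).symm)
  tensor f g := by
    refine (congrArg F.mapArrow.obj (hA.tensor (Arrow.mk f) (Arrow.mk g))).trans ?_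
    refine (map_actArrow hF _ _ _).trans (Eq.trans ?_
      (hB.tensor (Arrow.mk (F.map f)) (Arrow.mk (F.map g))).symm)
    exact congrArg (B.actArrow _ _) (funext fun | 0 => rfl | 1 => rfl)
  associator X X' X'' := by
    refine (congrArg F.mapArrow.obj (hA.associator X X' X'')).trans ?_
    refine (map_actArrow hF _ _ _).trans (Eq.trans ?_ (hB.associator _ _ _).symm)
    exact congrArg (B.actArrow _ _)
      (funext (α := Fin 3) fun | 0 => map_mk_id F X | 1 => map_mk_id F X' | 2 => map_mk_id F X'')
  leftUnitor X := by
    refine (congrArg F.mapArrow.obj (hA.leftUnitor X)).trans ?_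
    refine (map_actArrow hF _ _ _).trans (Eq.trans ?_ (hB.leftUnitor _).symm)
    exact congrArg (B.actArrow _ _) (funext (α := Fin 1) fun | 0 => map_mk_id F X)
  rightUnitor X := by
    refine (congrArg F.mapArrow.obj (hA.rightUnitor X)).trans ?_
    refine (map_actArrow hF _ _ _).trans (Eq.trans ?_ (hB.rightUnitor _).symm)
    exact congrArg (B.actArrow _ _) (funext (α := Fin 1) fun | 0 => map_mk_id F X)
  braiding X X' := by
    refine (congrArg F.mapArrow.obj (hA.braiding X X')).trans ?_
    refine (map_actArrow hF _ _ _).trans (Eq.trans ?_ (hB.braiding _ _).symm)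
    exact congrArg (B.actArrow _ _) (funext fun | 0 => map_mk_id F X | 1 => map_mk_id F X')

namespace IsStrictSymmMon

variable {F : C ⥤ D}


theorem obj_eval (hF : IsStrictSymmMon F) (T : FTree ι) (x : ι → C) :
    F.obj (T.eval x) = T.eval fun i => F.obj (x i) := by
  induction T with
  | unit => exact hF.unit
  | var i => rfl
  | node T U ihT ihU =>
    -- Preservation of tensor products of objects is the equality of sources in the condition for
    -- identities.
    refine (congrArg Arrow.left (hF.tensor (𝟙 (T.eval x)) (𝟙 (U.eval x)))).trans ?_
    exact congrArg₂ (· ⊗ ·) ihT ihU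

theorem map_evalMap (hF : IsStrictSymmMon F) (T : FTree ι) {x y : ι → C} (h : ∀ i, x i ⟶ y i) :
    Arrow.mk (F.map (T.evalMap h)) = Arrow.mk (T.evalMap fun i => F.map (h i)) := by
  induction T with
  | unit => exact (map_mk_id F _).trans (arrow_id_congr hF.unit)
  | var i => rfl
  | node T U ihT ihU => exact (hF.tensor _ _).trans (congrArg₂ tensorArrow ihT ihU)

theorem map_eval (hF : IsStrictSymmMon F) {T T' : FTree ι} (f : FHom T T') (x : ι → C) :
    Arrow.mk (F.map (f.eval x).hom) = Arrow.mk (f.eval fun i => F.obj (x i)).hom := by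
  induction f with
  | refl T => exact (map_mk_id F _).trans (arrow_id_congr (hF.obj_eval T x))
  | symm f ih => exact arrow_inv_congr (e := F.mapIso (f.eval x)) ih
  | trans f g ih ih' =>
    exact (congrArg Arrow.mk (F.map_comp _ _)).trans (arrow_comp_congr ih ih')
  | tensor f g ih ih' => exact (hF.tensor _ _).trans (congrArg₂ tensorArrow ih ih')
  | assoc T U V =>
    exact (hF.associator _ _ _).trans
      (arrow_associator_congr (hF.obj_eval T x) (hF.obj_eval U x) (hF.obj_eval V x))
  | lUnit T =>
    exact (hF.leftUnitor _).trans (congrArg (fun a => Arrow.mk (λ_ a).hom) (hF.obj_eval T x))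
  | rUnit T =>
    exact (hF.rightUnitor _).trans (congrArg (fun a => Arrow.mk (ρ_ a).hom) (hF.obj_eval T x))
  | braid T U =>
    exact (hF.braiding _ _).trans (arrow_braiding_congr (hF.obj_eval T x) (hF.obj_eval U x))

/-- In `C` and in `D` the action is the value of the same `yFHom p p'` followed by the value of the
same word, and `F` preserves both. -/
theorem isMap (hF : IsStrictSymmMon F) : (symmMonAlgebra C).IsMap (symmMonAlgebra D) F where
  map_act {_ p p'} _ {x _} h :=
    (congrArg Arrow.mk (F.map_comp _ _)).trans
      (arrow_comp_congr (hF.map_eval (yFHom p p') x) (hF.map_evalMap (yWord p') h))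

end IsStrictSymmMon

end Maps

/-! ### The isomorphism of categories -/

/-- The functor from symmetric monoidal categories to `Y`-algebras. -/
noncomputable def symmMonToAlg : SymmMonCat.{v, u} ⥤ OperadAlgCat.{v, u} Y where
  obj B := ⟨B.carrier, symmMonEquiv B.carrier B.str⟩
  map K := ⟨K.functor, K.isStrict.isMap⟩
  map_id _ := rfl
  map_comp _ _ := rfl

/-- The functor from `Y`-algebras to symmetric monoidal categories. -/
noncomputable def algToSymmMon : OperadAlgCat.{v, u} Y ⥤ SymmMonCat.{v, u} where
  obj A := ⟨A.carrier, (symmMonEquiv A.carrier).symm A.alg⟩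
  map {A B} K :=
    letI := A.alg.monoidalCategory
    letI := A.alg.symmetricCategory
    letI := B.alg.monoidalCategory
    letI := B.alg.symmetricCategory
    ⟨K.functor, K.isMap.isStrictSymmMon A.alg.readOff B.alg.readOff⟩
  map_id _ := rfl
  map_comp _ _ := rfl

/-- A round trip returns the structures only up to propositional equality, so maps are compared
heterogeneously; their underlying functors are literally the same. -/
theorem SymmMonCat.hom_heq {C D : Type u} [Category.{v} C] [Category.{v} D]
    {M M' : SymmMonStructure C} {N N' : SymmMonStructure D} (hM : M = M') (hN : N = N')
    (f : SymmMonCat.Hom ⟨C, M⟩ ⟨D, N⟩) (g : SymmMonCat.Hom ⟨C, M'⟩ ⟨D, N'⟩)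
    (h : f.functor = g.functor) : f ≍ g := by
  subst hM hN
  exact heq_of_eq (SymmMonCat.Hom.ext h)

theorem OperadAlgCat.hom_heq {P : CatOperad} {C D : Type u} [Category.{v} C] [Category.{v} D]
    {M M' : OperadAlgebra P C} {N N' : OperadAlgebra P D} (hM : M = M') (hN : N = N')
    (f : OperadAlgCat.Hom ⟨C, M⟩ ⟨D, N⟩) (g : OperadAlgCat.Hom ⟨C, M'⟩ ⟨D, N'⟩)
    (h : f.functor = g.functor) : f ≍ g := by
  subst hM hN
  exact heq_of_eq (OperadAlgCat.Hom.ext h)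

theorem symmMonToAlg_comp_algToSymmMon :
    symmMonToAlg ⋙ algToSymmMon = 𝟭 SymmMonCat.{v, u} :=
  CategoryTheory.Functor.hext
    (fun B => congrArg (SymmMonCat.mk B.carrier) ((symmMonEquiv B.carrier).symm_apply_apply B.str))
    fun B B' K => SymmMonCat.hom_heq ((symmMonEquiv B.carrier).symm_apply_apply B.str)
      ((symmMonEquiv B'.carrier).symm_apply_apply B'.str) _ K rfl

theorem algToSymmMon_comp_symmMonToAlg :
    algToSymmMon ⋙ symmMonToAlg = 𝟭 (OperadAlgCat.{v, u} Y) :=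
  CategoryTheory.Functor.hext
    (fun A => congrArg (OperadAlgCat.mk A.carrier) ((symmMonEquiv A.carrier).apply_symm_apply A.alg))
    fun A A' K => OperadAlgCat.hom_heq ((symmMonEquiv A.carrier).apply_symm_apply A.alg)
      ((symmMonEquiv A'.carrier).apply_symm_apply A'.alg) _ K rfl

end ELZ


theorem theorem3 :
    ∃ Φ : ∀ (C : Type u) [Category.{v} C], SymmMonStructure C ≃ OperadAlgebra Y C,
      (∀ (C : Type u) [Category.{v} C] (M : SymmMonStructure C), Corresponds M (Φ C M)) ∧
      ∃ (F : SymmMonCat.{v, u} ⥤ OperadAlgCat.{v, u} Y) (G : OperadAlgCat.{v, u} Y ⥤ SymmMonCat.{v, u}),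
        F ⋙ G = 𝟭 SymmMonCat.{v, u} ∧ G ⋙ F = 𝟭 (OperadAlgCat.{v, u} Y) ∧
        (∀ B : SymmMonCat.{v, u}, F.obj B = ⟨B.carrier, Φ B.carrier B.str⟩) ∧
        (∀ A : OperadAlgCat.{v, u} Y, G.obj A = ⟨A.carrier, (Φ A.carrier).symm A.alg⟩) ∧
        F ⋙ OperadAlgCat.forget Y = SymmMonCat.forget ∧ G ⋙ SymmMonCat.forget = OperadAlgCat.forget Y :=
  -- Both functors leave carriers and underlying functors untouched, so the conditions on objects
  -- and on the forgetful functors hold by definition.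
  ⟨fun C _ => symmMonEquiv C, fun _ _ M => M.corresponds_algebra, symmMonToAlg, algToSymmMon,
    symmMonToAlg_comp_algToSymmMon, algToSymmMon_comp_symmMonToAlg, fun _ => rfl, fun _ => rfl,
    rfl, rfl⟩
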